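/- Let $(X,d,\mu)$ be a complete metric space with a Borel measure $\mu$ that is doubling, $0<\mu(B_{2r}(x))\le C_\mu\,\mu(B_r(x))<\infty$ for all $x\in X$, $r>0$, and supports a weak $(1,1)$-Poincaré inequality. Let $\Omega\subset X$ be open, $0<T<\infty$, $\Omega_T=\Omega\times(0,T)$. We write $A\Subset B$ if $\overline A$ is a compact subset of $B$. For an open set $A\subset X$ and $w\in L^1_{\mathrm{loc}}(A)$ the total variation is $$\|Dw\|(A)=\inf\Big\{\liminf_{i\to\infty}\int_A g_i\,d\mu\Big\},$$ the infimum being taken over all sequences of functions $w_i\in\mathrm{Lip}_{\mathrm{loc}}(A)$ with $w_i\to w$ in $L^1_{\mathrm{loc}}(A)$ and of $1$-weak upper gradients $g_i$ of $w_i$ in $A$. (Here $\mathrm{Lip}_{\mathrm{loc}}(A)$ consists of the functions that are Lipschitz on every compact subset of $A$, and a $\mu$-measurable $g\ge 0$ is a $1$-weak upper gradient of $v$ in $A$ if $|v(x)-v(y)|\le\int_\gamma g\,ds$ for all rectifiable paths $\gamma$ in $A$, with endpoints $x,y$, outside a family of zero $1$-modulus.) For a function $u$ on $\Omega_T$ we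 write $u(t)=u(\cdot,t)$, and $\|Du(t)\|$ is the total variation of the function $u(t)$. The space $L^1_{\mathrm{loc}}(0,T;BV_{\mathrm{loc}}(\Omega))$ consists of the measurable functions $u:\Omega_T\to\mathbb R$ with $$\int_{t_1}^{t_2}\big(\|u(t)\|_{L^1(\Omega')}+\|Du(t)\|(\Omega')\big)\,dt<\infty$$ for all open $\Omega'\Subset\Omega$ and $0<t_1<t_2<T$. A function $u\in L^1_{\mathrm{loc}}(0,T;BV_{\mathrm{loc}}(\Omega))$ is a variational solution to the total variation flow in $\Omega_T$ if for every $\varphi\in\mathrm{Lip}(\Omega_T)$ with $\operatorname{supp}\varphi\Subset\Omega_T$ there are an open set $U\subset\Omega$ and $0\le s_1<s_2\le T$ with $\operatorname{supp}\varphi\subset U\times(s_1,s_2)$ and $\int_{s_1}^{s_2}\|Du(t)\|(U)\,dt<\infty$ such that $$\int_{s_1}^{s_2}\Big(\int_{U}-u(t)\frac{\partial\varphi}{\partial t}(t)\,d\mu+\|Du(t)\|(U)\Big)dt\le\int_{s_1}^{s_2}\|D(u+\varphi)(t)\|(U)\,dt.\qquad(1)$$ (In particular, $u$ is a variational solution if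 $\int_0^T\|Du(t)\|(\Omega)\,dt<\infty$ and (1) holds with $U=\Omega$, $s_1=0$, $s_2=T$ for all such $\varphi$.) **Proposition.** Let $u$ be a variational solution to the total variation flow in $\Omega_T$. Then there is a set $N\subset(0,T)$ of Lebesgue measure zero such that for all $t_1<t_2$ in $(0,T)\setminus N$, all open $\Omega'\Subset\Omega$, and all $\varphi\in\mathrm{Lip}(\Omega_T)$ with $\operatorname{supp}\varphi\Subset\Omega'\times(0,T)$, all integrals below exist and are finite, and $$\int_{t_1}^{t_2}\Big(\int_{\Omega'}-u(t)\frac{\partial\varphi}{\partial t}(t)\,d\mu+\|Du(t)\|(\Omega')\Big)dt\le\int_{t_1}^{t_2}\|D(u+\varphi)(t)\|(\Omega')\,dt-\Big(\int_{\Omega'}u(t_2)\varphi(t_2)\,d\mu-\int_{\Omega'}u(t_1)\varphi(t_1)\,d\mu\Big).$$ -/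

import Mathlib

open MeasureTheory Set Filter Topology
open scoped ENNReal NNReal

noncomputable section

namespace TVF

variable {X : Type*} [MetricSpace X] [MeasurableSpace X]

/-! ### Paths, modulus and upper gradients -/

/-- A rectifiable path in `X`, parametrized by arc length on `[0, length]`. (Every rectifiable path
has such a parametrization, with the same endpoints, image and line integrals; only the values on
`[0, length]` matter.) -/
structure RectPath (X : Type*) [MetricSpace X] where
  length : ℝ≥0
  toFun : ℝ → X
  unitSpeed : HasUnitSpeedOn toFun (Icc 0 (length : ℝ))

/-- The path runs inside the set `A`. -/
def RectPath.InSet (γ : RectPath X) (A : Set X) : Prop :=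
  ∀ s ∈ Icc (0 : ℝ) γ.length, γ.toFun s ∈ A

/-- The line integral `∫_γ ρ ds` of a nonnegative function. -/
def RectPath.lineIntegral (γ : RectPath X) (ρ : X → ℝ≥0∞) : ℝ≥0∞ :=
  ∫⁻ s in Icc (0 : ℝ) γ.length, ρ (γ.toFun s)

/-- The upper gradient inequality `|v(x) - v(y)| ≤ ∫_γ g ds` on the path `γ` with endpoints
`x`, `y`. -/
def RectPath.UpperGradientIneq (γ : RectPath X) (v : X → ℝ) (g : X → ℝ≥0∞) : Prop :=
  ENNReal.ofReal |v (γ.toFun γ.length) - v (γ.toFun 0)| ≤ γ.lineIntegral g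

/-- The `1`-modulus of a family of paths. -/
def modulusOne (μ : Measure X) (Γ : Set (RectPath X)) : ℝ≥0∞ :=
  ⨅ (ρ : X → ℝ≥0∞) (_ : Measurable ρ) (_ : ∀ γ ∈ Γ, 1 ≤ γ.lineIntegral ρ), ∫⁻ x, ρ x ∂μ

/-- `g` is an upper gradient of the real-valued function `v` on `X`. -/
def IsUpperGradient (v : X → ℝ) (g : X → ℝ≥0∞) : Prop :=
  Measurable g ∧ ∀ γ : RectPath X, γ.UpperGradientIneq v g

/-- `g` is a `1`-weak upper gradient of `v` in the set `A`: the upper gradient inequality holds for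
all paths in `A` outside a family of zero `1`-modulus. -/
def IsWeakUpperGradientOn (μ : Measure X) (A : Set X) (v : X → ℝ) (g : X → ℝ≥0∞) : Prop :=
  AEMeasurable g (μ.restrict A) ∧
    modulusOne μ {γ : RectPath X | γ.InSet A ∧ ¬ γ.UpperGradientIneq v g} = 0

/-! ### Assumptions on the space -/

/-- The doubling condition `0 < μ(B_{2r}(x)) ≤ C μ(B_r(x)) < ∞`. -/
def IsDoubling (μ : Measure X) : Prop :=
  ∃ C : ℝ≥0, 1 ≤ C ∧ ∀ (x : X) (r : ℝ), 0 < r →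
    0 < μ (Metric.ball x (2 * r)) ∧
    μ (Metric.ball x (2 * r)) ≤ C * μ (Metric.ball x r) ∧
    μ (Metric.ball x r) < ⊤

/-- The weak `(1,1)`-Poincaré inequality. -/
def SupportsPoincare (μ : Measure X) : Prop :=
  ∃ C τ : ℝ, 0 < C ∧ 1 ≤ τ ∧ ∀ (x : X) (r : ℝ), 0 < r →
    ∀ (v : X → ℝ) (g : X → ℝ≥0∞), LocallyIntegrable v μ → IsUpperGradient v g →
      ⨍⁻ y in Metric.ball x r, ‖v y - ⨍ z in Metric.ball x r, v z ∂μ‖ₑ ∂μ ≤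
        ENNReal.ofReal (C * r) * ⨍⁻ y in Metric.ball x (τ * r), g y ∂μ

/-! ### Total variation -/

/-- `v ∈ Lip_loc(A)`: Lipschitz continuous on compact subsets of `A`. -/
def IsLipLocOn (A : Set X) (v : X → ℝ) : Prop :=
  ∀ K ⊆ A, IsCompact K → ∃ L : ℝ≥0, LipschitzOnWith L v K

/-- `v i → w` in `L¹_loc(A)`. -/
def TendstoL1Loc (μ : Measure X) (A : Set X) (v : ℕ → X → ℝ) (w : X → ℝ) : Prop :=
  ∀ K ⊆ A, IsCompact K → Tendsto (fun i => ∫⁻ x in K, ‖v i x - w x‖ₑ ∂μ) atTop (𝓝 0)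

/-- The total variation `‖Dw‖(A)` of `w ∈ L¹_loc(A)` on an open set `A`: the infimum of
`liminf ∫_A g_i dμ` over all sequences of `v i ∈ Lip_loc(A)` converging to `w` in `L¹_loc(A)`, and
`1`-weak upper gradients `g i` of `v i` in `A`. -/
def totalVariation (μ : Measure X) (w : X → ℝ) (A : Set X) : ℝ≥0∞ :=
  ⨅ (v : ℕ → X → ℝ) (g : ℕ → X → ℝ≥0∞)
    (_ : ∀ i, IsLipLocOn A (v i))
    (_ : ∀ i, IsWeakUpperGradientOn μ A (v i) (g i))
    (_ : TendstoL1Loc μ A v w),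
    liminf (fun i => ∫⁻ x in A, g i x ∂μ) atTop

/-! ### Functions of space and time -/

/-- `∫_{s₁}^{s₂} ‖Du(t)‖(A) dt`, the total variation being that of the slice `u(t) = u(·, t)`. -/
def timeTotalVariation (μ : Measure X) (u : X × ℝ → ℝ) (A : Set X) (s₁ s₂ : ℝ) : ℝ≥0∞ :=
  ∫⁻ t in Ioo s₁ s₂, totalVariation μ (fun x => u (x, t)) A

/-- The time derivative `∂φ/∂t`, which for Lipschitz `φ` exists almost everywhere. -/
def timeDeriv (φ : X × ℝ → ℝ) (x : X) (t : ℝ) : ℝ :=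
  deriv (fun s => φ (x, s)) t

/-- `A ⋐ B` for an open set `A`. -/
def CompactlyInside (A B : Set X) : Prop :=
  IsOpen A ∧ IsCompact (closure A) ∧ closure A ⊆ B

/-- `u ∈ L¹_loc(0,T; BV_loc(Ω))`: `u` is measurable on `Ω × (0,T)`, and
`∫_{t₁}^{t₂} (‖u(t)‖_{L¹(Ω')} + ‖Du(t)‖(Ω')) dt < ∞` whenever `Ω' × (t₁,t₂) ⋐ Ω × (0,T)`. -/
structure MemL1LocBVLoc (μ : Measure X) (Ω : Set X) (T : ℝ) (u : X × ℝ → ℝ) : Prop where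
  aestronglyMeasurable :
    AEStronglyMeasurable u ((μ.prod volume).restrict (Ω ×ˢ Ioo 0 T))
  lintegral_lt_top : ∀ Ω' : Set X, CompactlyInside Ω' Ω → ∀ t₁ t₂ : ℝ, 0 < t₁ → t₁ < t₂ → t₂ < T →
    ∫⁻ t in Ioo t₁ t₂,
      ((∫⁻ x in Ω', ‖u (x, t)‖ₑ ∂μ) + totalVariation μ (fun x => u (x, t)) Ω') < ⊤

/-- `φ` is a Lipschitz function on `A × (s₁,s₂)` whose support is a compact subset of
`A × (s₁,s₂)`. Such functions are regarded as extended by zero; the extension is Lipschitz on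
`X × ℝ`. -/
structure IsTestFunction (A : Set X) (s₁ s₂ : ℝ) (φ : X × ℝ → ℝ) : Prop where
  lipschitz : ∃ L : ℝ≥0, LipschitzWith L φ
  hasCompactSupport : HasCompactSupport φ
  tsupport_subset : tsupport φ ⊆ A ×ˢ Ioo s₁ s₂

/-- `u` is a variational solution to the total variation flow in `Ω × (0,T)`.

The variational inequality for the test function `φ` compares total variations over `Ω × (0,T)`.
For `u ∈ L¹_loc(0,T; BV_loc(Ω))` these may be infinite, and the comparison `∞ ≤ ∞` says nothing
about `u`. It is therefore required on some cylinder `U × (s₁,s₂) ⊆ Ω × (0,T)` that contains the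
support of `φ` and on which the total variation of `u` is finite. If it is finite on
`Ω × (0,T)`, then `U = Ω`, `s₁ = 0`, `s₂ = T` is allowed. -/
def IsVariationalSolution (μ : Measure X) (Ω : Set X) (T : ℝ) (u : X × ℝ → ℝ) : Prop :=
  MemL1LocBVLoc μ Ω T u ∧
  ∀ φ : X × ℝ → ℝ, IsTestFunction Ω 0 T φ →
    ∃ (U : Set X) (s₁ s₂ : ℝ), IsOpen U ∧ U ⊆ Ω ∧ 0 ≤ s₁ ∧ s₁ < s₂ ∧ s₂ ≤ T ∧
      tsupport φ ⊆ U ×ˢ Ioo s₁ s₂ ∧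
      timeTotalVariation μ u U s₁ s₂ < ⊤ ∧
      ((∫ t in Ioo s₁ s₂, ∫ x in U, -(u (x, t) * timeDeriv φ x t) ∂μ : ℝ) : EReal)
          + (timeTotalVariation μ u U s₁ s₂ : EReal)
        ≤ (timeTotalVariation μ (u + φ) U s₁ s₂ : EReal)

end TVF

end

noncomputable section

namespace TVF

/-! ### Doubling and completeness make the space proper -/

section Space

variable {X : Type*} [MetricSpace X] [MeasurableSpace X] {μ : Measure X}

/-! Insert `θ φ` into the variational inequality, where `θ` is the `trapezoid` cutoff in time with
ramps of length `h` at `t₁` and `t₂`. By the product rule the derivative term becomes `∫ θ ∫ u ∂ₜφ`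
plus the average of `m(t) = ∫ u(t) φ(t) dμ` over `(t₁, t₁ + h)` minus that over `(t₂ - h, t₂)`
(`integral_mul_timeDeriv_trapezoid`). As `h → 0` the averages tend to the boundary terms if `t₁`,
`t₂` are good times. On `(t₁, t₂)`, the functions `u + θ φ` and `u + φ` differ only on the two
ramps, where the total variation of the former is at most `‖Du(t)‖(Ω') + L μ(Ω')`; this contributes
nothing in the limit (`timeTotalVariation_add_trapezoid_le`).

Good times must not depend on `φ` or `Ω'`. They are therefore Lebesgue points of the Bochner map `t
↦ u(t) ∈ L¹(A)` rather than of `m`, with `A` running through a countable exhaustion of `Ω`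
(`exists_null_set`); every Lipschitz `φ` then has convergent averages
(`tendsto_average_integral_mul`).

The main work is localization: the inequality holds on a cylinder `U × (s₁, s₂)` that varies with
the test function, and is wanted on `Ω' × (t₁, t₂)`. The bridge is
`totalVariation_add_le_of_eq_off_compact`, which with `w₁ = u + φ`, `w₂ = u` reads `‖D(u+φ)‖(U) +
‖Du‖(Ω') ≤ ‖Du‖(U) + ‖D(u+φ)‖(Ω')`. Adding this to the given inequality and cancelling the finite
terms over `U` moves it to `Ω'`; no additivity of `‖Dw‖` as a set function is needed. The exchange
glues approximations of `w₂` on `U` and of `w₁` on `V` by a cutoff `ψ`, once with weights `(1 - ψ,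
ψ)` and once reversed. By the Leibniz rule the two gradients add up to `g + g'` plus an error
supported where `ψ` varies; there `w₁ = w₂`, so the error vanishes in the limit.

Integrating the exchange in time requires measurability of `t ↦ ‖D(u+φ)(t)‖(Ω')`, which follows from
lower semicontinuity of the total variation on `L¹` and measurability of the `L¹`-valued slice map.
-/

theorem measure_ball_two_pow_mul_le {C : ℝ≥0}
    (hC : ∀ (x : X) (r : ℝ), 0 < r → μ (Metric.ball x (2 * r)) ≤ C * μ (Metric.ball x r))
    (x : X) {r : ℝ} (hr : 0 < r) (k : ℕ) :
    μ (Metric.ball x (2 ^ k * r)) ≤ (C : ℝ≥0∞) ^ k * μ (Metric.ball x r) := by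
  induction k with
  | zero => simp
  | succ k ih =>
    calc μ (Metric.ball x (2 ^ (k + 1) * r)) = μ (Metric.ball x (2 * (2 ^ k * r))) := by
          congr 2; ring
      _ ≤ C * μ (Metric.ball x (2 ^ k * r)) := hC x _ (by positivity)
      _ ≤ C * ((C : ℝ≥0∞) ^ k * μ (Metric.ball x r)) := by gcongr
      _ = (C : ℝ≥0∞) ^ (k + 1) * μ (Metric.ball x r) := by ring

theorem IsDoubling.measure_ball_pos (hμ : IsDoubling μ) (x : X) {r : ℝ} (hr : 0 < r) :
    0 < μ (Metric.ball x r) := by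
  obtain ⟨C, -, h⟩ := hμ
  have := (h x (r / 2) (by positivity)).1
  rwa [mul_div_cancel₀ r two_ne_zero] at this

theorem IsDoubling.measure_ball_lt_top (hμ : IsDoubling μ) (x : X) (r : ℝ) :
    μ (Metric.ball x r) < ⊤ := by
  obtain ⟨C, -, h⟩ := hμ
  exact (measure_mono (Metric.ball_subset_ball (le_max_left r 1))).trans_lt
    (h x (max r 1) (by positivity)).2.2

theorem IsDoubling.isLocallyFiniteMeasure (hμ : IsDoubling μ) : IsLocallyFiniteMeasure μ :=
  ⟨fun x => ⟨Metric.ball x 1, Metric.ball_mem_nhds x one_pos, hμ.measure_ball_lt_top x 1⟩⟩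

variable [BorelSpace X]

/-- Packing argument: an infinite `ε`-separated sequence would give infinitely many disjoint balls,
each of measure bounded below by doubling, inside one ball of finite measure. -/
theorem IsDoubling.totallyBounded_closedBall (hμ : IsDoubling μ) (x : X) (R : ℝ) :
    TotallyBounded (Metric.closedBall x R) := by
  obtain ⟨C, hC1, hC⟩ := id hμ
  rw [Metric.totallyBounded_iff]
  intro ε hε
  by_contra! hcon
  obtain ⟨f, hf, hsep⟩ := exists_seq_of_forall_finset_exists (fun y => y ∈ Metric.closedBall x R)
    (fun y z => ε ≤ dist z y) (fun s _ => by
      obtain ⟨y, hy, hy'⟩ := not_subset.1 (hcon (s : Set X) s.finite_toSet)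
      refine ⟨y, hy, fun z hz => ?_⟩
      simp only [mem_iUnion, not_exists, Metric.mem_ball, not_lt] at hy'
      exact hy' z hz)
  have hR : 0 ≤ R := dist_nonneg.trans (Metric.mem_closedBall.1 (hf 0))
  -- After `k` doublings the ball of radius `ε / 2` about any `f n` contains `ball x (R + ε)`, since
  -- `f n` is within `R` of `x`.
  obtain ⟨k, hk⟩ := pow_unbounded_of_one_lt ((2 * R + ε) / (ε / 2)) (one_lt_two (α := ℝ))
  have hk' : 2 * R + ε < 2 ^ k * (ε / 2) := by rwa [div_lt_iff₀ (by positivity)] at hk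
  have hCpos : (0 : ℝ≥0∞) < (C : ℝ≥0∞) ^ k :=
    ENNReal.pow_pos (by exact_mod_cast zero_lt_one.trans_le hC1) k
  have hlow : ∀ n, μ (Metric.ball x (R + ε)) / (C : ℝ≥0∞) ^ k ≤ μ (Metric.ball (f n) (ε / 2)) := by
    intro n
    refine ENNReal.div_le_of_le_mul' ?_
    refine le_trans (measure_mono ?_) (measure_ball_two_pow_mul_le (fun x r hr => (hC x r hr).2.1)
      (f n) (half_pos hε) k)
    refine Metric.ball_subset_ball' ?_
    have := Metric.mem_closedBall.1 (hf n)
    rw [dist_comm] at this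
    linarith
  have hdisj : Pairwise (Function.onFun Disjoint fun n => Metric.ball (f n) (ε / 2)) := by
    intro m n hmn
    refine Metric.ball_disjoint_ball ?_
    rcases lt_or_gt_of_ne hmn with h | h
    · have := hsep m n h; rw [dist_comm] at this; linarith
    · have := hsep n m h; linarith
  have hfin := Measure.finite_const_le_meas_of_disjoint_iUnion μ
    (ε := μ (Metric.ball x (R + ε)) / (C : ℝ≥0∞) ^ k)
    (ENNReal.div_pos (hμ.measure_ball_pos x (by positivity)).ne' (by simp))
    (fun n => measurableSet_ball) hdisj (by
      refine ((measure_mono ?_).trans_lt (hμ.measure_ball_lt_top x (R + ε))).ne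
      refine iUnion_subset fun n => Metric.ball_subset_ball' ?_
      have := Metric.mem_closedBall.1 (hf n)
      linarith)
  refine infinite_univ (hfin.subset fun n _ => hlow n)

theorem IsDoubling.properSpace [CompleteSpace X] (hμ : IsDoubling μ) : ProperSpace X :=
  ⟨fun x R => (hμ.totallyBounded_closedBall x R).isCompact_of_isClosed
    Metric.isClosed_closedBall⟩

end Space

/-! ### Subpaths, modulus, and replacing weak upper gradients by upper gradients -/

section Paths

variable {X : Type*} [MetricSpace X]

theorem RectPath.lipschitzOnWith (γ : RectPath X) :
    LipschitzOnWith 1 γ.toFun (Icc 0 (γ.length : ℝ)) := by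
  have key : ∀ s ∈ Icc (0 : ℝ) γ.length, ∀ t ∈ Icc (0 : ℝ) γ.length, s ≤ t →
      edist (γ.toFun s) (γ.toFun t) ≤ edist s t := by
    intro s hs t ht hst
    have h := γ.unitSpeed hs ht
    rw [NNReal.coe_one, one_mul] at h
    rw [edist_comm s t, edist_dist t s, Real.dist_eq, abs_of_nonneg (sub_nonneg.2 hst), ← h]
    exact eVariationOn.edist_le _ ⟨hs, left_mem_Icc.2 hst⟩ ⟨ht, right_mem_Icc.2 hst⟩
  intro s hs t ht
  rw [ENNReal.coe_one, one_mul]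
  rcases le_total s t with h | h
  · exact key s hs t ht h
  · rw [edist_comm, edist_comm s]
    exact key t ht s hs h

theorem RectPath.continuousOn (γ : RectPath X) : ContinuousOn γ.toFun (Icc 0 (γ.length : ℝ)) :=
  γ.lipschitzOnWith.continuousOn

/-- The restriction of a path to `[a, b] ⊆ [0, length]`. -/
def RectPath.subpath (γ : RectPath X) {a b : ℝ} (ha : 0 ≤ a) (hab : a ≤ b)
    (hb : b ≤ γ.length) : RectPath X where
  length := ⟨b - a, sub_nonneg.2 hab⟩
  toFun s := γ.toFun (a + s)
  unitSpeed := by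
    intro s hs t ht
    change s ∈ Icc 0 (b - a) at hs
    change t ∈ Icc 0 (b - a) at ht
    change eVariationOn (fun s => γ.toFun (a + s)) (Icc 0 (b - a) ∩ Icc s t) = _
    have h := γ.unitSpeed (x := a + s) ⟨by linarith [hs.1], by linarith [hs.2]⟩
      (y := a + t) ⟨by linarith [ht.1], by linarith [ht.2]⟩
    rw [add_sub_add_left_eq_sub] at h
    rw [← h]
    have himg : (fun s => a + s) '' (Icc 0 (b - a) ∩ Icc s t)
        = Icc 0 (γ.length : ℝ) ∩ Icc (a + s) (a + t) := by
      ext x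
      simp only [mem_image, mem_inter_iff, mem_Icc]
      constructor
      · rintro ⟨y, hy, rfl⟩
        exact ⟨⟨by linarith [hy.1.1], by linarith [hy.1.2]⟩, by linarith [hy.2.1],
          by linarith [hy.2.2]⟩
      · intro hx
        exact ⟨x - a, ⟨⟨by linarith [hs.1, hx.2.1], by linarith [ht.2, hx.2.2]⟩,
          by linarith [hx.2.1], by linarith [hx.2.2]⟩, by ring⟩
    rw [← himg]
    exact eVariationOn.comp_eq_of_monotoneOn γ.toFun (fun s => a + s)
      (fun x _ y _ hxy => by simpa using hxy)

theorem RectPath.subpath_inSet (γ : RectPath X) {a b : ℝ} (ha : 0 ≤ a) (hab : a ≤ b)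
    (hb : b ≤ γ.length) {A : Set X} (h : ∀ s ∈ Icc a b, γ.toFun s ∈ A) :
    (γ.subpath ha hab hb).InSet A := by
  intro s hs
  change s ∈ Icc 0 (b - a) at hs
  exact h (a + s) ⟨by linarith [hs.1], by linarith [hs.2]⟩

theorem RectPath.subpath_lineIntegral (γ : RectPath X) {a b : ℝ} (ha : 0 ≤ a) (hab : a ≤ b)
    (hb : b ≤ γ.length) (ρ : X → ℝ≥0∞) :
    (γ.subpath ha hab hb).lineIntegral ρ = ∫⁻ s in Icc a b, ρ (γ.toFun s) := by
  change ∫⁻ s in Icc 0 (b - a), ρ (γ.toFun (a + s)) = _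
  have h := (measurePreserving_add_left volume a).setLIntegral_comp_preimage_emb
    (MeasurableEquiv.addLeft a).measurableEmbedding (fun s => ρ (γ.toFun s)) (Icc a b)
  rw [← h]
  simp

theorem RectPath.UpperGradientIneq.subpath {γ : RectPath X} {a b : ℝ} {ha : 0 ≤ a} {hab : a ≤ b}
    {hb : b ≤ γ.length} {v : X → ℝ} {g : X → ℝ≥0∞}
    (h : (γ.subpath ha hab hb).UpperGradientIneq v g) :
    ENNReal.ofReal |v (γ.toFun b) - v (γ.toFun a)| ≤ ∫⁻ s in Icc a b, g (γ.toFun s) := by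
  have := h
  rw [RectPath.UpperGradientIneq, RectPath.subpath_lineIntegral] at this
  change ENNReal.ofReal |v (γ.toFun (a + (b - a))) - v (γ.toFun (a + 0))| ≤ _ at this
  simpa using this

variable [MeasurableSpace X]

/-- `g` is a Borel upper gradient of `v` along every path in `A`. -/
def IsUpperGradientOn (A : Set X) (v : X → ℝ) (g : X → ℝ≥0∞) : Prop :=
  Measurable g ∧ ∀ γ : RectPath X, γ.InSet A → γ.UpperGradientIneq v g

theorem IsUpperGradientOn.edist_le {A : Set X} {v : X → ℝ} {g : X → ℝ≥0∞}
    (h : IsUpperGradientOn A v g) (γ : RectPath X) {a b : ℝ} (ha : 0 ≤ a) (hab : a ≤ b)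
    (hb : b ≤ γ.length) (hA : ∀ s ∈ Icc a b, γ.toFun s ∈ A) :
    ENNReal.ofReal |v (γ.toFun b) - v (γ.toFun a)| ≤ ∫⁻ s in Icc a b, g (γ.toFun s) :=
  (h.2 _ (γ.subpath_inSet ha hab hb hA)).subpath

variable {μ : Measure X}

/-- Every positive multiple of `ρ` still has infinite line integrals, so it is admissible, and its
integral can be made arbitrarily small. -/
theorem modulusOne_eq_zero_of_lineIntegral_eq_top {Γ : Set (RectPath X)} {ρ : X → ℝ≥0∞}
    (hρ : Measurable ρ) (hfin : ∫⁻ x, ρ x ∂μ ≠ ⊤) (htop : ∀ γ ∈ Γ, γ.lineIntegral ρ = ⊤) :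
    modulusOne μ Γ = 0 := by
  have hle : ∀ n : ℕ, modulusOne μ Γ ≤ ((n : ℝ≥0∞) + 1)⁻¹ * ∫⁻ x, ρ x ∂μ := by
    intro n
    rw [← lintegral_const_mul _ hρ]
    refine iInf_le_of_le (fun x => ((n : ℝ≥0∞) + 1)⁻¹ * ρ x) (iInf_le_of_le (hρ.const_mul _)
      (iInf_le_of_le (fun γ hγ => ?_) le_rfl))
    rw [RectPath.lineIntegral, lintegral_const_mul' _ _ (by simp)]
    have := htop γ hγ
    rw [RectPath.lineIntegral] at this
    rw [this, ENNReal.mul_top (by simp)]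
    exact le_top
  have hlim : Tendsto (fun n : ℕ => ((n : ℝ≥0∞) + 1)⁻¹ * ∫⁻ x, ρ x ∂μ) atTop (𝓝 0) := by
    have h0 : Tendsto (fun n : ℕ => ((n : ℝ≥0∞) + 1)⁻¹) atTop (𝓝 0) := by
      have := (tendsto_add_atTop_iff_nat 1).2 ENNReal.tendsto_inv_nat_nhds_zero
      simpa using this
    simpa using ENNReal.Tendsto.mul_const h0 (Or.inr hfin)
  exact le_antisymm (ge_of_tendsto' hlim hle) bot_le

theorem IsUpperGradientOn.isWeakUpperGradientOn {A : Set X} {v : X → ℝ} {g : X → ℝ≥0∞}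
    (h : IsUpperGradientOn A v g) : IsWeakUpperGradientOn μ A v g := by
  refine ⟨h.1.aemeasurable, ?_⟩
  refine modulusOne_eq_zero_of_lineIntegral_eq_top (ρ := 0) measurable_const (by simp) ?_
  rintro γ ⟨hA, hn⟩
  exact absurd (h.2 γ hA) hn

variable [BorelSpace X]

theorem RectPath.aemeasurable_comp (γ : RectPath X) {ρ : X → ℝ≥0∞} (hρ : Measurable ρ) :
    AEMeasurable (fun s => ρ (γ.toFun s)) (volume.restrict (Icc 0 (γ.length : ℝ))) :=
  hρ.comp_aemeasurable (γ.continuousOn.aemeasurable measurableSet_Icc)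

/-- A family of zero modulus is carried by a function of small integral. -/
theorem exists_lineIntegral_eq_top_of_modulusOne_eq_zero {Γ : Set (RectPath X)}
    (hΓ : modulusOne μ Γ = 0) {ε : ℝ≥0∞} (hε : ε ≠ 0) :
    ∃ ρ : X → ℝ≥0∞, Measurable ρ ∧ ∫⁻ x, ρ x ∂μ ≤ ε ∧ ∀ γ ∈ Γ, γ.lineIntegral ρ = ⊤ := by
  obtain ⟨δ, hδ, hδε⟩ := ENNReal.exists_pos_sum_of_countable hε ℕ
  have : ∀ n, ∃ ρ : X → ℝ≥0∞, Measurable ρ ∧ (∀ γ ∈ Γ, 1 ≤ γ.lineIntegral ρ) ∧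
      ∫⁻ x, ρ x ∂μ < δ n := by
    intro n
    have h : modulusOne μ Γ < δ n := by rw [hΓ]; exact_mod_cast hδ n
    simp only [modulusOne, iInf_lt_iff] at h
    obtain ⟨ρ, h1, h2, h3⟩ := h
    exact ⟨ρ, h1, h2, h3⟩
  choose ρ hm h1 hlt using this
  -- Each summand has line integral at least `1`, so the sum has infinite line integral on `Γ`,
  -- while its total integral stays below `∑ δ n < ε`.
  refine ⟨fun x => ∑' n, ρ n x, Measurable.tsum hm, ?_, ?_⟩
  · rw [lintegral_tsum fun n => (hm n).aemeasurable]
    exact (ENNReal.tsum_le_tsum fun n => (hlt n).le).trans hδε.le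
  · intro γ hγ
    rw [RectPath.lineIntegral, lintegral_tsum fun n => γ.aemeasurable_comp (hm n)]
    refine top_unique ?_
    calc (⊤ : ℝ≥0∞) = ∑' _ : ℕ, (1 : ℝ≥0∞) :=
          (ENNReal.tsum_const_eq_top_of_ne_zero one_ne_zero).symm
      _ ≤ _ := ENNReal.tsum_le_tsum fun n => h1 n γ hγ

/-- A `1`-weak upper gradient is, up to a small error in the integral, an upper gradient. -/
theorem IsWeakUpperGradientOn.exists_isUpperGradientOn {A : Set X} (hA : MeasurableSet A)
    {v : X → ℝ} {g : X → ℝ≥0∞} (h : IsWeakUpperGradientOn μ A v g) {ε : ℝ≥0∞} (hε : ε ≠ 0) :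
    ∃ g' : X → ℝ≥0∞, IsUpperGradientOn A v g' ∧ ∫⁻ x, g' x ∂μ ≤ (∫⁻ x in A, g x ∂μ) + ε := by
  obtain ⟨ρ, hρ, hρε, htop⟩ := exists_lineIntegral_eq_top_of_modulusOne_eq_zero h.2 hε
  set k := h.1.mk g with hk
  have hkm : Measurable k := h.1.measurable_mk
  set N := toMeasurable (μ.restrict A) {x | g x ≠ k x} with hN
  have hN0 : μ.restrict A N = 0 := by
    rw [hN, measure_toMeasurable]
    exact h.1.ae_eq_mk
  have hNm : MeasurableSet N := measurableSet_toMeasurable _ _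
  have hgle : ∀ x, g x ≤ k x + N.indicator (fun _ => ⊤) x := by
    intro x
    by_cases hx : x ∈ N
    · simp [hx]
    · have : g x = k x := by
        by_contra hne
        exact hx (subset_toMeasurable _ _ hne)
      simp [this]
  -- Line integrals do not respect almost-everywhere equality, so `g` must be dominated pointwise:
  -- by its Borel version `k`, with `⊤` added on a Borel null set containing all disagreement. The
  -- term `ρ` makes the inequality trivial on exceptional paths.
  refine ⟨A.indicator fun x => (k x + N.indicator (fun _ => ⊤) x) + ρ x,
    ⟨((hkm.add (measurable_const.indicator hNm)).add hρ).indicator hA, fun γ hγ => ?_⟩, ?_⟩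
  · have hind : γ.lineIntegral (A.indicator fun x => (k x + N.indicator (fun _ => ⊤) x) + ρ x)
        = γ.lineIntegral fun x => (k x + N.indicator (fun _ => ⊤) x) + ρ x :=
      setLIntegral_congr_fun measurableSet_Icc fun s hs => indicator_of_mem (hγ s hs) _
    rw [RectPath.UpperGradientIneq, hind]
    by_cases hbad : γ.UpperGradientIneq v g
    · exact le_trans hbad (lintegral_mono fun s => (hgle _).trans le_self_add)
    · have : γ.lineIntegral ρ = ⊤ := htop γ ⟨hγ, hbad⟩
      refine le_top.trans (this.symm.le.trans (lintegral_mono fun s => ?_))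
      exact le_add_self
  · rw [lintegral_indicator hA, lintegral_add_right _ hρ]
    refine add_le_add ?_ ((setLIntegral_le_lintegral _ _).trans hρε)
    rw [lintegral_add_left hkm, lintegral_indicator hNm, setLIntegral_measure_zero _ _ hN0,
      add_zero]
    exact (lintegral_congr_ae h.1.ae_eq_mk).symm.le

end Paths

/-! ### One-variable calculus along a path -/

section Calculus

/-- A Lipschitz function on `[0, l]` whose derivative is bounded by `G` almost everywhere changes
by at most the integral of `G`. -/
theorem ofReal_abs_sub_le_lintegral {h : ℝ → ℝ} {l : ℝ} (hl : 0 ≤ l) {K : ℝ≥0}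
    (hh : LipschitzOnWith K h (Icc 0 l)) {G : ℝ → ℝ≥0∞}
    (hG : ∀ᵐ s, s ∈ Ioo 0 l → ∀ d, HasDerivAt h d s → ENNReal.ofReal |d| ≤ G s) :
    ENNReal.ofReal |h l - h 0| ≤ ∫⁻ s in Icc 0 l, G s := by
  have hac : AbsolutelyContinuousOnInterval h 0 l :=
    LipschitzOnWith.absolutelyContinuousOnInterval (by rwa [uIcc_of_le hl])
  have hdiff := hac.ae_differentiableAt
  rw [← hac.integral_deriv_eq_sub, intervalIntegral.integral_of_le hl, ← Real.norm_eq_abs,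
    ofReal_norm, restrict_Ioc_eq_restrict_Icc]
  refine (enorm_integral_le_lintegral_enorm _).trans ?_
  rw [← restrict_Ioo_eq_restrict_Icc]
  refine setLIntegral_mono_ae' measurableSet_Ioo ?_
  filter_upwards [hdiff, hG] with s h1 h2 hs
  rw [← ofReal_norm, Real.norm_eq_abs]
  exact h2 hs _ (h1 (by rw [uIcc_of_le hl]; exact Ioo_subset_Icc_self hs)).hasDerivAt

/-- Right Lebesgue points of a nonnegative function. -/
theorem ae_lintegral_eq_ofReal_hasDerivWithinAt {l : ℝ} {G : ℝ → ℝ≥0∞}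
    (hG : AEMeasurable G (volume.restrict (Icc 0 l))) (hfin : ∫⁻ s in Icc 0 l, G s ≠ ⊤) :
    ∀ᵐ s, s ∈ Ioo 0 l → G s ≠ ⊤ ∧ ∃ F : ℝ → ℝ, F s = 0 ∧
      HasDerivAt F (G s).toReal s ∧
      ∀ t ∈ Ioo s l, (∫⁻ r in Icc s t, G r) = ENNReal.ofReal (F t) ∧ 0 ≤ F t := by
  rcases lt_or_ge 0 l with hl | hl
  swap
  · exact Eventually.of_forall fun s hs => absurd (hs.1.trans hs.2) (not_lt.2 hl)
  have hint : IntegrableOn (fun s => (G s).toReal) (Icc 0 l) :=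
    integrable_toReal_of_lintegral_ne_top hG hfin
  have hii : IntervalIntegrable (fun s => (G s).toReal) volume 0 l := by
    rw [intervalIntegrable_iff_integrableOn_Icc_of_le hl.le]
    exact hint
  have hlt := ae_lt_top' hG hfin
  rw [ae_restrict_iff' measurableSet_Icc] at hlt
  filter_upwards [hlt, hii.ae_hasDerivAt_integral] with s h1 h2 hs
  have hs' := Ioo_subset_Icc_self hs
  refine ⟨(h1 hs').ne, fun x => ∫ r in s..x, (G r).toReal, by simp,
    h2 (by rwa [uIcc_of_le hl.le]) s (by rwa [uIcc_of_le hl.le]), fun t ht => ⟨?_, ?_⟩⟩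
  · have hsub : Icc s t ⊆ Icc 0 l := Icc_subset_Icc hs.1.le ht.2.le
    beta_reduce
    rw [intervalIntegral.integral_of_le ht.1.le, ← integral_Icc_eq_integral_Ioc,
      integral_toReal (hG.mono_set hsub), ENNReal.ofReal_toReal]
    · exact ne_top_of_le_ne_top hfin (lintegral_mono_set hsub)
    · refine ae_restrict_of_ae_restrict_of_subset hsub (ae_lt_top' hG hfin)
  · exact intervalIntegral.integral_nonneg ht.1.le fun _ _ => ENNReal.toReal_nonneg

/-- The derivative of a function is controlled by the right derivatives of a majorant of its
increments. -/
theorem abs_deriv_le_of_increment_le {h p q F F' : ℝ → ℝ} {s d e e' c : ℝ}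
    (hd : HasDerivAt h d s) (hp : ContinuousWithinAt p (Ioi s) s)
    (hq : ContinuousWithinAt q (Ioi s) s) (hF : HasDerivAt F e s) (hF0 : F s = 0)
    (hF' : HasDerivAt F' e' s) (hF'0 : F' s = 0)
    (hle : ∀ᶠ t in 𝓝[>] s, |h t - h s| ≤ p t * F' t + q t * F t + c * (t - s)) :
    |d| ≤ p s * e' + q s * e + c := by
  have slope_tendsto : ∀ {f : ℝ → ℝ} {f' : ℝ}, HasDerivAt f f' s →
      -- Right slopes suffice: `h` is differentiable at `s`, and its increments are controlled only
      -- for `t > s`.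
      Tendsto (fun t => (t - s)⁻¹ * (f t - f s)) (𝓝[>] s) (𝓝 f') := by
    intro f f' hf
    have := (hasDerivAt_iff_tendsto_slope.1 hf).mono_left
      (nhdsWithin_mono s (show Ioi s ⊆ {s}ᶜ from fun t ht => ne_of_gt ht))
    simpa [slope_fun_def] using this
  have h1 := (slope_tendsto hd).abs
  have h2 : Tendsto (fun t => p t * ((t - s)⁻¹ * (F' t - F' s)) + q t * ((t - s)⁻¹ * (F t - F s))
      + c) (𝓝[>] s) (𝓝 (p s * e' + q s * e + c)) :=
    ((hp.tendsto.mul (slope_tendsto hF')).add (hq.tendsto.mul (slope_tendsto hF))).add_const c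
  refine le_of_tendsto_of_tendsto h1 h2 ?_
  filter_upwards [hle, self_mem_nhdsWithin] with t ht hst
  have hpos : 0 < t - s := sub_pos.2 hst
  rw [abs_mul, abs_of_pos (inv_pos.2 hpos), hF0, hF'0, sub_zero, sub_zero]
  calc (t - s)⁻¹ * |h t - h s| ≤ (t - s)⁻¹ * (p t * F' t + q t * F t + c * (t - s)) := by gcongr
    _ = _ := by field_simp

end Calculus

/-! ### Locally Lipschitz functions and Lipschitz multipliers -/

section LipLoc

variable {X : Type*} [MetricSpace X]

theorem IsLipLocOn.continuousOn [LocallyCompactSpace X] {A : Set X} (hA : IsOpen A) {v : X → ℝ}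
    (hv : IsLipLocOn A v) : ContinuousOn v A := by
  intro x hx
  obtain ⟨K, hK, hxK, hKA⟩ := exists_compact_subset hA hx
  obtain ⟨L, hL⟩ := hv K hKA hK
  exact (hL.continuousOn.continuousAt (mem_interior_iff_mem_nhds.1 hxK)).continuousWithinAt

theorem isLipLocOn_of_lipschitzWith {L : ℝ≥0} {v : X → ℝ} (hv : LipschitzWith L v) (A : Set X) :
    IsLipLocOn A v := fun _ _ _ => ⟨L, hv.lipschitzOnWith⟩

theorem IsLipLocOn.add {A : Set X} {v w : X → ℝ} (hv : IsLipLocOn A v) (hw : IsLipLocOn A w) :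
    IsLipLocOn A (fun x => v x + w x) := by
  intro K hKA hK
  obtain ⟨L, hL⟩ := hv K hKA hK
  obtain ⟨M, hM⟩ := hw K hKA hK
  exact ⟨L + M, hL.add hM⟩

/-- On compact sets, a bounded Lipschitz multiple of a Lipschitz function is Lipschitz. -/
theorem lipschitzOnWith_mul_of_isCompact {K : Set X} (hK : IsCompact K) {f ψ : X → ℝ} {L M : ℝ≥0}
    (hf : LipschitzOnWith L f K) (hψ : LipschitzWith M ψ) (hψ1 : ∀ x, |ψ x| ≤ 1) :
    ∃ N : ℝ≥0, (∀ x ∈ K, M * |f x| ≤ N) ∧ LipschitzOnWith N (fun x => ψ x * f x) K := by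
  obtain ⟨B, hB⟩ := hK.exists_bound_of_continuousOn hf.continuousOn
  set B' : ℝ≥0 := B.toNNReal with hB'
  have hBx : ∀ x ∈ K, |f x| ≤ B' := fun x hx => (hB x hx).trans (Real.le_coe_toNNReal B)
  refine ⟨L + M * B', fun x hx => ?_, LipschitzOnWith.of_dist_le_mul fun x hx y hy => ?_⟩
  · push_cast
    have := mul_le_mul_of_nonneg_left (hBx x hx) M.coe_nonneg
    linarith [L.coe_nonneg]
  · have h1 := hf.dist_le_mul x hx y hy
    have h2 := hψ.dist_le_mul x y
    rw [Real.dist_eq] at h1 h2 ⊢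
    have : ψ x * f x - ψ y * f y = ψ x * (f x - f y) + (ψ x - ψ y) * f y := by ring
    rw [this]
    calc |ψ x * (f x - f y) + (ψ x - ψ y) * f y|
        ≤ |ψ x| * |f x - f y| + |ψ x - ψ y| * |f y| := by
          rw [← abs_mul, ← abs_mul]; exact abs_add_le _ _
      _ ≤ 1 * (L * dist x y) + (M * dist x y) * B' := by
          gcongr
          · exact hψ1 x
          · exact hBx y hy
      _ = _ := by push_cast; ring

theorem IsLipLocOn.mul {A : Set X} {f ψ : X → ℝ} {M : ℝ≥0} (hf : IsLipLocOn A f)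
    (hψ : LipschitzWith M ψ) (hψ1 : ∀ x, |ψ x| ≤ 1) : IsLipLocOn A (fun x => ψ x * f x) := by
  intro K hKA hK
  obtain ⟨L, hL⟩ := hf K hKA hK
  obtain ⟨N, -, hN⟩ := lipschitzOnWith_mul_of_isCompact hK hL hψ hψ1
  exact ⟨N, hN⟩

/-- A compactly supported Lipschitz multiple of a locally Lipschitz function is Lipschitz. -/
theorem IsLipLocOn.exists_lipschitzWith_mul {A Z : Set X} {f ψ : X → ℝ} {M : ℝ≥0}
    (hf : IsLipLocOn A f) (hψ : LipschitzWith M ψ) (hψ1 : ∀ x, |ψ x| ≤ 1) (hZ : IsCompact Z)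
    (hZA : Z ⊆ A) (hψZ : ∀ x ∉ Z, ψ x = 0) : ∃ N : ℝ≥0, LipschitzWith N (fun x => ψ x * f x) := by
  obtain ⟨L, hL⟩ := hf Z hZA hZ
  obtain ⟨N, hN0, hN⟩ := lipschitzOnWith_mul_of_isCompact hZ hL hψ hψ1
  -- Across the boundary of `Z` nothing is known about `f y`, but `ψ y = 0` forces `|ψ x| ≤ M * dist
  -- x y`; this is where the bound `M * |f x| ≤ N` is needed.
  have key : ∀ x ∈ Z, ∀ y ∉ Z, |ψ x * f x| ≤ N * dist x y := by
    intro x hx y hy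
    have h2 := hψ.dist_le_mul x y
    rw [Real.dist_eq, hψZ y hy, sub_zero] at h2
    rw [abs_mul]
    calc |ψ x| * |f x| ≤ (M * dist x y) * |f x| := by gcongr
      _ = (M * |f x|) * dist x y := by ring
      _ ≤ N * dist x y := by gcongr; exact hN0 x hx
  refine ⟨N, LipschitzWith.of_dist_le_mul fun x y => ?_⟩
  by_cases hx : x ∈ Z <;> by_cases hy : y ∈ Z
  · exact hN.dist_le_mul x hx y hy
  · simpa [Real.dist_eq, hψZ y hy] using key x hx y hy
  · rw [dist_comm, dist_comm x]
    simpa [Real.dist_eq, hψZ x hx] using key y hy x hx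
  · simp only [Real.dist_eq, hψZ x hx, hψZ y hy, zero_mul, sub_zero, abs_zero]
    positivity

end LipLoc

/-! ### The Leibniz rule for upper gradients -/

section Leibniz

variable {X : Type*} [MetricSpace X] {U V S Z : Set X} {v v' ψ : X → ℝ} {g g' : X → ℝ≥0∞} {L : ℝ≥0}

/-- The gradient of `ψ v' + (1 - ψ) v` given by the Leibniz rule, where `ψ` is `L`-Lipschitz and
locally constant outside `S`. -/
def leibnizGradient (ψ : X → ℝ) (S : Set X) (L : ℝ≥0) (v v' : X → ℝ) (g g' : X → ℝ≥0∞) :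
    X → ℝ≥0∞ := fun x =>
  ENNReal.ofReal (ψ x) * g' x + ENNReal.ofReal (1 - ψ x) * g x +
    S.indicator (fun x => L * ‖v' x - v x‖ₑ) x

/-- Outside `V` nothing is known about `v'`, but `ψ` vanishes off the compact set `Z ⊆ V`, so `ψ v'`
is globally Lipschitz. -/
theorem IsLipLocOn.convexCombination (hv : IsLipLocOn U v) (hv' : IsLipLocOn V v')
    (hψ : LipschitzWith L ψ) (h01 : ∀ x, ψ x ∈ Icc (0 : ℝ) 1) (hZ : IsCompact Z) (hZV : Z ⊆ V)
    (hψZ : ∀ x ∉ Z, ψ x = 0) : IsLipLocOn U (fun x => ψ x * v' x + (1 - ψ x) * v x) := by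
  obtain ⟨N, hN⟩ := hv'.exists_lipschitzWith_mul hψ
    (fun x => abs_le.2 ⟨by linarith [(h01 x).1], (h01 x).2⟩) hZ hZV hψZ
  refine (isLipLocOn_of_lipschitzWith hN U).add (hv.mul (M := L) ?_
    fun x => abs_le.2 ⟨by linarith [(h01 x).2], by linarith [(h01 x).1]⟩)
  refine LipschitzWith.of_dist_le_mul fun x y => ?_
  have := hψ.dist_le_mul x y
  rw [Real.dist_eq, abs_sub_comm] at this
  rw [Real.dist_eq]
  convert this using 2
  ring

variable [MeasurableSpace X] [BorelSpace X]

/-- The Leibniz rule along a path. -/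
theorem RectPath.upperGradientIneq_leibniz (hV : IsOpen V) (hv : IsLipLocOn U v)
    (hv' : IsLipLocOn V v') (hg : IsUpperGradientOn U v g) (hg' : IsUpperGradientOn V v' g')
    (hψ : LipschitzWith L ψ) (h01 : ∀ x, ψ x ∈ Icc (0 : ℝ) 1)
    (hS : ∀ x ∉ S, ∀ᶠ y in 𝓝 x, ψ y = ψ x) (hZ : IsCompact Z) (hZV : Z ⊆ V)
    (hψZ : ∀ x ∉ Z, ψ x = 0) {γ : RectPath X} (hγ : γ.InSet U) (hfin : γ.lineIntegral g ≠ ⊤)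
    (hfin' : γ.lineIntegral g' ≠ ⊤) :
    γ.UpperGradientIneq (fun x => ψ x * v' x + (1 - ψ x) * v x)
      (leibnizGradient ψ S L v v' g g') := by
  set h : X → ℝ := fun x => ψ x * v' x + (1 - ψ x) * v x with hh
  set l : ℝ := (γ.length : ℝ) with hl
  have hl0 : 0 ≤ l := γ.length.coe_nonneg
  have hlip : IsLipLocOn U h := hv.convexCombination hv' hψ h01 hZ hZV hψZ
  have himg : IsCompact (γ.toFun '' Icc 0 l) := isCompact_Icc.image_of_continuousOn γ.continuousOn
  obtain ⟨N, hN⟩ := hlip _ (image_subset_iff.2 fun s hs => hγ s hs) himg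
  have hcomp : LipschitzOnWith (N * 1) (fun s => h (γ.toFun s)) (Icc 0 l) :=
    hN.comp γ.lipschitzOnWith (mapsTo_image _ _)
  refine ofReal_abs_sub_le_lintegral (h := fun s => h (γ.toFun s)) hl0 hcomp ?_
  -- At almost every `s` the primitives `F`, `F'` of `g ∘ γ`, `g' ∘ γ` started at `s` are
  -- differentiable there with the right values, and they majorize the increments of `v` and `v'`
  -- along `γ`.
  filter_upwards [ae_lintegral_eq_ofReal_hasDerivWithinAt (γ.aemeasurable_comp hg.1) hfin,
    ae_lintegral_eq_ofReal_hasDerivWithinAt (γ.aemeasurable_comp hg'.1) hfin'] with s h1 h2 hs d hd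
  obtain ⟨hgs, F, hF0, hF, hFt⟩ := h1 hs
  obtain ⟨hgs', F', hF'0, hF', hF't⟩ := h2 hs
  have hIcc : Icc 0 l ∈ 𝓝 s := Icc_mem_nhds hs.1 hs.2
  have hγc : ContinuousAt γ.toFun s := γ.continuousOn.continuousAt hIcc
  have hψc : ContinuousAt (fun t => ψ (γ.toFun t)) s := hψ.continuous.continuousAt.comp hγc
  have hlt : ∀ᶠ t in 𝓝[>] s, t ∈ Ioo s l :=
    Ioo_mem_nhdsGT hs.2
  have hinc : ∀ t ∈ Ioo s l, |v (γ.toFun t) - v (γ.toFun s)| ≤ F t := by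
    intro t ht
    have := hg.edist_le γ hs.1.le ht.1.le ht.2.le
      fun r hr => hγ r ⟨hs.1.le.trans hr.1, hr.2.trans ht.2.le⟩
    rw [(hFt t ht).1] at this
    exact (ENNReal.ofReal_le_ofReal_iff (hFt t ht).2).1 this
  have hψt : ∀ t ∈ Ioo s l, |ψ (γ.toFun t) - ψ (γ.toFun s)| ≤ L * (t - s) := by
    intro t ht
    have h3 := hψ.dist_le_mul (γ.toFun t) (γ.toFun s)
    have h4 := γ.lipschitzOnWith.dist_le_mul t ⟨hs.1.le.trans ht.1.le, ht.2.le⟩ s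
      (Ioo_subset_Icc_self hs)
    rw [NNReal.coe_one, one_mul, Real.dist_eq, abs_of_pos (sub_pos.2 ht.1)] at h4
    rw [Real.dist_eq] at h3
    exact h3.trans (by gcongr)
  -- The inequality for `v'` is available only for subpaths in `V`. If `γ s ∈ Z`, short subpaths
  -- from `s` stay in `V`; otherwise the glued function equals `v` near `s`, and `v'` plays no role.
  by_cases hsZ : γ.toFun s ∈ Z
  · have hsV : ∀ᶠ t in 𝓝[>] s, ∀ r ∈ Icc s t, γ.toFun r ∈ V := by
      have hV' : ∀ᶠ r in 𝓝 s, γ.toFun r ∈ V := hγc (hV.mem_nhds (hZV hsZ))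
      obtain ⟨ε, hε, hball⟩ := Metric.eventually_nhds_iff.1 hV'
      filter_upwards [Ioo_mem_nhdsGT (show s < s + ε by linarith)] with t ht r hr
      refine hball ?_
      rw [Real.dist_eq, abs_of_nonneg (sub_nonneg.2 hr.1)]
      linarith [hr.2, ht.2]
    set c : ℝ := S.indicator (fun x => L * |v' x - v x|) (γ.toFun s) with hc
    -- The cutoff term is at most `L |v' - v|` times the time increment, and it disappears off `S`,
    -- where `ψ` is locally constant.
    have hcr : ∀ᶠ t in 𝓝[>] s, |ψ (γ.toFun t) - ψ (γ.toFun s)| * |v' (γ.toFun s) - v (γ.toFun s)|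
        ≤ c * (t - s) := by
      by_cases hsS : γ.toFun s ∈ S
      · filter_upwards [hlt] with t ht
        rw [hc, indicator_of_mem hsS]
        calc _ ≤ (L * (t - s)) * |v' (γ.toFun s) - v (γ.toFun s)| := by
              gcongr; exact hψt t ht
          _ = _ := by ring
      · have := (hγc.eventually (hS _ hsS)).filter_mono
          (nhdsWithin_le_nhds (s := Ioi s))
        filter_upwards [this] with t ht
        rw [ht, hc, indicator_of_notMem hsS]
        simp
    have hmain := abs_deriv_le_of_increment_le (p := fun t => ψ (γ.toFun t))
      (q := fun t => 1 - ψ (γ.toFun t)) (c := c) hd hψc.continuousWithinAt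
      (continuousAt_const.sub hψc).continuousWithinAt hF hF0 hF' hF'0 (by
        filter_upwards [hlt, hsV, hcr] with t ht htV htc
        have hinc' : |v' (γ.toFun t) - v' (γ.toFun s)| ≤ F' t := by
          have := hg'.edist_le γ hs.1.le ht.1.le ht.2.le htV
          rw [(hF't t ht).1] at this
          exact (ENNReal.ofReal_le_ofReal_iff (hF't t ht).2).1 this
        have heq : h (γ.toFun t) - h (γ.toFun s)
            = ψ (γ.toFun t) * (v' (γ.toFun t) - v' (γ.toFun s))
              + (1 - ψ (γ.toFun t)) * (v (γ.toFun t) - v (γ.toFun s))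
              + (ψ (γ.toFun t) - ψ (γ.toFun s)) * (v' (γ.toFun s) - v (γ.toFun s)) := by
          rw [hh]; ring
        have hp := (h01 (γ.toFun t)).1
        have hq : 0 ≤ 1 - ψ (γ.toFun t) := sub_nonneg.2 (h01 (γ.toFun t)).2
        rw [heq]
        refine (abs_add_three _ _ _).trans ?_
        rw [abs_mul, abs_mul, abs_mul, abs_of_nonneg hp, abs_of_nonneg hq]
        gcongr
        exact hinc t ht)
    have hp := (h01 (γ.toFun s)).1
    have hq : 0 ≤ 1 - ψ (γ.toFun s) := sub_nonneg.2 (h01 (γ.toFun s)).2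
    have hc0 : 0 ≤ c := indicator_nonneg (fun _ _ => by positivity) _
    refine (ENNReal.ofReal_le_ofReal hmain).trans (le_of_eq ?_)
    rw [ENNReal.ofReal_add (by positivity) hc0, ENNReal.ofReal_add (by positivity) (by positivity),
      ENNReal.ofReal_mul hp, ENNReal.ofReal_mul hq, ENNReal.ofReal_toReal hgs',
      ENNReal.ofReal_toReal hgs, leibnizGradient]
    congr 1
    by_cases hsS : γ.toFun s ∈ S
    · rw [hc, indicator_of_mem hsS, indicator_of_mem hsS, ENNReal.ofReal_mul L.coe_nonneg,
        ENNReal.ofReal_coe_nnreal, ← Real.norm_eq_abs, ofReal_norm]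
    · rw [hc, indicator_of_notMem hsS, indicator_of_notMem hsS, ENNReal.ofReal_zero]
  · have hsZ' : ∀ᶠ t in 𝓝[>] s, γ.toFun t ∉ Z :=
      (hγc.eventually (hZ.isClosed.isOpen_compl.mem_nhds hsZ)).filter_mono nhdsWithin_le_nhds
    have hmain := abs_deriv_le_of_increment_le (p := fun _ => 0) (q := fun _ => 1) (c := 0) hd
      continuousWithinAt_const continuousWithinAt_const hF hF0 hF' hF'0 (by
        filter_upwards [hlt, hsZ'] with t ht htZ
        have : h (γ.toFun t) - h (γ.toFun s) = v (γ.toFun t) - v (γ.toFun s) := by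
          rw [hh]; simp [hψZ _ htZ, hψZ _ hsZ]
        rw [this]
        simpa using hinc t ht)
    refine (ENNReal.ofReal_le_ofReal hmain).trans ?_
    rw [zero_mul, zero_add, one_mul, add_zero, ENNReal.ofReal_toReal hgs, leibnizGradient]
    simp only [hψZ _ hsZ, ENNReal.ofReal_zero, zero_mul, sub_zero, ENNReal.ofReal_one, one_mul,
      zero_add]
    exact le_self_add

variable [LocallyCompactSpace X] {μ : Measure X}

/-- The Leibniz rule for `1`-weak upper gradients. -/
theorem IsUpperGradientOn.leibniz (hU : IsOpen U) (hV : IsOpen V) (hv : IsLipLocOn U v)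
    (hv' : IsLipLocOn V v') (hg : IsUpperGradientOn U v g) (hg' : IsUpperGradientOn V v' g')
    (hfin : ∫⁻ x, g x ∂μ ≠ ⊤) (hfin' : ∫⁻ x, g' x ∂μ ≠ ⊤)
    (hψ : LipschitzWith L ψ) (h01 : ∀ x, ψ x ∈ Icc (0 : ℝ) 1)
    (hSm : MeasurableSet S) (hSUV : S ⊆ U ∩ V)
    (hS : ∀ x ∉ S, ∀ᶠ y in 𝓝 x, ψ y = ψ x) (hZ : IsCompact Z) (hZV : Z ⊆ V)
    (hψZ : ∀ x ∉ Z, ψ x = 0) :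
    IsWeakUpperGradientOn μ U (fun x => ψ x * v' x + (1 - ψ x) * v x)
      (leibnizGradient ψ S L v v' g g') := by
  constructor
  · refine AEMeasurable.restrict ?_
    have hψm : Measurable ψ := hψ.continuous.measurable
    refine (((hψm.ennreal_ofReal.mul hg'.1).add
      ((measurable_const.sub hψm).ennreal_ofReal.mul hg.1)).aemeasurable).add ?_
    refine (aemeasurable_indicator_iff hSm).2 (AEMeasurable.const_mul (AEMeasurable.enorm ?_) _)
    refine ContinuousOn.aemeasurable ?_ hSm
    exact ((hv'.continuousOn hV).mono fun x hx => (hSUV hx).2).sub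
      ((hv.continuousOn hU).mono fun x hx => (hSUV hx).1)
  -- The exceptional paths are those along which `g` or `g'` has infinite integral; `g + g'` itself
  -- witnesses that they have zero modulus.
  · refine modulusOne_eq_zero_of_lineIntegral_eq_top (ρ := fun x => g x + g' x) (hg.1.add hg'.1)
      ?_ ?_
    · rw [lintegral_add_left hg.1]
      exact ENNReal.add_ne_top.2 ⟨hfin, hfin'⟩
    · rintro γ ⟨hγ, hn⟩
      by_contra hne
      refine hn (RectPath.upperGradientIneq_leibniz hV hv hv' hg hg' hψ h01 hS hZ hZV hψZ hγ
        ?_ ?_)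
      · exact ne_top_of_le_ne_top hne (lintegral_mono fun s => le_self_add)
      · exact ne_top_of_le_ne_top hne (lintegral_mono fun s => le_add_self)

end Leibniz

/-! ### Cutoff functions and compact exhaustions -/

section Cutoff

variable {X : Type*} [MetricSpace X] [ProperSpace X]

/-- Lipschitz cutoff functions. -/
theorem exists_lipschitz_cutoff {K W : Set X} (hK : IsCompact K) (hW : IsOpen W) (hKW : K ⊆ W) :
    ∃ (ψ : X → ℝ) (L : ℝ≥0) (S Z : Set X), LipschitzWith L ψ ∧ (∀ x, ψ x ∈ Icc (0 : ℝ) 1) ∧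
      (IsCompact S ∧ S ⊆ W ∧ Disjoint S K ∧ ∀ x ∉ S, ∀ᶠ y in 𝓝 x, ψ y = ψ x) ∧
      (IsCompact Z ∧ Z ⊆ W ∧ ∀ x ∉ Z, ψ x = 0) ∧ ∀ x ∈ K, ψ x = 1 := by
  -- `Metric.infDist` to the empty set is `0` by convention, so the formula for `ψ` below would give
  -- `1` everywhere.
  rcases K.eq_empty_or_nonempty with rfl | hne
  · exact ⟨fun _ => 0, 0, ∅, ∅, LipschitzWith.const 0, fun _ => ⟨le_rfl, zero_le_one⟩,
      ⟨isCompact_empty, empty_subset _, disjoint_bot_left, fun _ _ => Eventually.of_forall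
        fun _ => rfl⟩, ⟨isCompact_empty, empty_subset _, fun _ _ => rfl⟩, fun x hx => hx.elim⟩
  obtain ⟨δ', hδ', hsub⟩ := hK.exists_cthickening_subset_open hW hKW
  set δ := δ' / 2 with hδdef
  have hδ : 0 < δ := half_pos hδ'
  have h2δ : δ' = 2 * δ := by rw [hδdef]; ring
  have hcont := Metric.continuous_infDist_pt K
  have hcth : Metric.cthickening δ' K = {x | Metric.infDist x K ≤ 2 * δ} := by
    ext x
    rw [Metric.mem_cthickening_iff, ← h2δ, mem_ofPred_eq, Metric.infDist,
      ENNReal.le_ofReal_iff_toReal_le (Metric.infEDist_ne_top hne) hδ'.le]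
  have hZc : IsCompact {x | Metric.infDist x K ≤ 2 * δ} := by
    rw [← hcth]; exact hK.cthickening
  rw [hcth] at hsub
  -- `ψ` is `1` up to distance `δ` from `K` and `0` beyond `2 * δ`. Starting the descent at `δ`
  -- rather than `0` keeps the shell `S` disjoint from `K`.
  set ψ : X → ℝ := fun x => max 0 (min 1 (2 - δ⁻¹ * Metric.infDist x K)) with hψ
  have hle : ∀ x, Metric.infDist x K ≤ δ → ψ x = 1 := by
    intro x hx
    have : δ⁻¹ * Metric.infDist x K ≤ 1 := by rw [inv_mul_le_iff₀ hδ]; linarith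
    rw [hψ]
    beta_reduce
    rw [min_eq_left (by linarith), max_eq_right zero_le_one]
  have hge : ∀ x, 2 * δ ≤ Metric.infDist x K → ψ x = 0 := by
    intro x hx
    have : 2 ≤ δ⁻¹ * Metric.infDist x K := by rw [le_inv_mul_iff₀ hδ]; linarith
    rw [hψ]
    exact max_eq_left (min_le_of_right_le (by linarith))
  refine ⟨ψ, (δ⁻¹).toNNReal, {x | Metric.infDist x K ≤ 2 * δ} ∩ {x | δ ≤ Metric.infDist x K},
    {x | Metric.infDist x K ≤ 2 * δ}, ?_, fun x => ⟨le_max_left _ _, max_le zero_le_one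
      (min_le_left _ _)⟩, ⟨hZc.inter_right (isClosed_le continuous_const hcont),
        inter_subset_left.trans hsub, ?_, ?_⟩, ⟨hZc, hsub, ?_⟩, ?_⟩
  · refine LipschitzWith.const_max (LipschitzWith.const_min ?_ _) _
    refine LipschitzWith.of_dist_le_mul fun x y => ?_
    rw [Real.coe_toNNReal _ (inv_pos.2 hδ).le, Real.dist_eq]
    have := (Metric.lipschitz_infDist_pt K).dist_le_mul y x
    rw [NNReal.coe_one, one_mul, Real.dist_eq, dist_comm] at this
    have h2 : 2 - δ⁻¹ * Metric.infDist x K - (2 - δ⁻¹ * Metric.infDist y K)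
        = δ⁻¹ * (Metric.infDist y K - Metric.infDist x K) := by ring
    rw [h2, abs_mul, abs_of_pos (inv_pos.2 hδ)]
    gcongr
  · rw [disjoint_left]
    rintro x ⟨-, hx⟩ hxK
    rw [mem_ofPred_eq, Metric.infDist_zero_of_mem hxK] at hx
    linarith
  · intro x hx
    rcases lt_or_ge (Metric.infDist x K) δ with h | h
    · filter_upwards [hcont.continuousAt.eventually_lt continuousAt_const h] with y hy
      rw [hle x h.le, hle y hy.le]
    · have h' : 2 * δ < Metric.infDist x K := by
        by_contra hcon
        exact hx ⟨not_lt.1 hcon, h⟩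
      filter_upwards [continuousAt_const.eventually_lt hcont.continuousAt h'] with y hy
      rw [hge x h'.le, hge y hy.le]
  · intro x hx
    exact hge x (not_le.1 hx).le
  · intro x hx
    exact hle x (by rw [Metric.infDist_zero_of_mem hx]; exact hδ.le)

theorem exists_compact_exhaustion {A : Set X} (hA : IsOpen A) :
    ∃ E : ℕ → Set X, (∀ n, IsCompact (E n)) ∧ (∀ n, E n ⊆ A) ∧ Monotone E ∧
      ∀ K ⊆ A, IsCompact K → ∃ n, K ⊆ interior (E n) := by
  have := hA.locallyCompactSpace
  let E := CompactExhaustion.choice A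
  refine ⟨fun n => Subtype.val '' E n, fun n => Subtype.isCompact_iff.1 (E.isCompact n),
    fun n => by rintro _ ⟨x, -, rfl⟩; exact x.2, fun m n hmn => image_mono (E.subset hmn),
    fun K hKA hK => ?_⟩
  have hK' : IsCompact (Subtype.val ⁻¹' K : Set A) := by
    rw [Subtype.isCompact_iff, Subtype.image_preimage_coe, inter_eq_right.2 hKA]
    exact hK
  obtain ⟨n, hn⟩ := E.exists_superset_of_isCompact hK'
  refine ⟨n + 1, fun x hx => ?_⟩
  exact hA.isOpenMap_subtype_val.image_interior_subset _
    ⟨⟨x, hKA hx⟩, E.subset_interior_succ n (hn hx), rfl⟩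

end Cutoff

/-! ### Total variation: approximation, Lipschitz perturbation, exchange inequality -/

section TotalVariation

theorem ENNReal_liminf_add_liminf_le (u v : ℕ → ℝ≥0∞) :
    liminf u atTop + liminf v atTop ≤ liminf (fun n => u n + v n) atTop := by
  simp only [liminf_eq_iSup_iInf_of_nat]
  rw [ENNReal.iSup_add_iSup_of_monotone]
  · refine iSup_mono fun n => le_iInf₂ fun i hi => ?_
    exact add_le_add (iInf₂_le i hi) (iInf₂_le i hi)
  · exact fun m n hmn => le_iInf₂ fun i hi => iInf₂_le i (hmn.trans hi)
  · exact fun m n hmn => le_iInf₂ fun i hi => iInf₂_le i (hmn.trans hi)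

variable {X : Type*} [MetricSpace X] [MeasurableSpace X] {μ : Measure X} {A U V : Set X}
  {w w₁ w₂ : X → ℝ}

theorem totalVariation_le_liminf {v : ℕ → X → ℝ} {g : ℕ → X → ℝ≥0∞}
    (hv : ∀ i, IsLipLocOn A (v i)) (hg : ∀ i, IsWeakUpperGradientOn μ A (v i) (g i))
    (hvw : TendstoL1Loc μ A v w) :
    totalVariation μ w A ≤ liminf (fun i => ∫⁻ x in A, g i x ∂μ) atTop :=
  iInf_le_of_le v <| iInf_le_of_le g <| iInf_le_of_le hv <| iInf_le_of_le hg <|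
    iInf_le_of_le hvw le_rfl

theorem totalVariation_congr_ae (h : w₁ =ᵐ[μ.restrict A] w₂) :
    totalVariation μ w₁ A = totalVariation μ w₂ A := by
  have : ∀ v, TendstoL1Loc μ A v w₁ ↔ TendstoL1Loc μ A v w₂ := by
    intro v
    refine forall₂_congr fun K hKA => forall_congr' fun _ => ?_
    have : ∀ i, ∫⁻ x in K, ‖v i x - w₁ x‖ₑ ∂μ = ∫⁻ x in K, ‖v i x - w₂ x‖ₑ ∂μ := by
      intro i
      refine lintegral_congr_ae ?_
      filter_upwards [ae_restrict_of_ae_restrict_of_subset hKA h] with x hx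
      rw [hx]
    simp only [this]
  simp only [totalVariation, this]

/-- Paths have unit speed, so the constant `L` integrates to `L` times the length, which bounds the
increment of `f`. -/
theorem IsUpperGradientOn.add_lipschitz {v f : X → ℝ} {g : X → ℝ≥0∞} {L : ℝ≥0}
    (h : IsUpperGradientOn A v g) (hf : LipschitzWith L f) :
    IsUpperGradientOn A (fun x => v x + f x) (fun x => g x + L) := by
  refine ⟨h.1.add_const _, fun γ hγ => ?_⟩
  have h1 := h.2 γ hγ
  have h0 : (0 : ℝ) ≤ γ.length := γ.length.coe_nonneg
  have h2 : ENNReal.ofReal |f (γ.toFun γ.length) - f (γ.toFun 0)|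
      ≤ L * volume (Icc (0 : ℝ) γ.length) := by
    have h3 := hf.dist_le_mul (γ.toFun γ.length) (γ.toFun 0)
    have h4 := γ.lipschitzOnWith.dist_le_mul γ.length (right_mem_Icc.2 h0) 0 (left_mem_Icc.2 h0)
    rw [NNReal.coe_one, one_mul, Real.dist_eq, sub_zero, abs_of_nonneg h0] at h4
    rw [Real.volume_Icc, sub_zero, ← ENNReal.ofReal_coe_nnreal (p := L),
      ← ENNReal.ofReal_mul L.coe_nonneg, ← Real.dist_eq]
    refine ENNReal.ofReal_le_ofReal (h3.trans ?_)
    gcongr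
  rw [RectPath.UpperGradientIneq, RectPath.lineIntegral, lintegral_add_right _ measurable_const,
    setLIntegral_const]
  refine le_trans ?_ (add_le_add h1 h2)
  rw [← ENNReal.ofReal_add (abs_nonneg _) (abs_nonneg _)]
  refine ENNReal.ofReal_le_ofReal ?_
  rw [add_sub_add_comm]
  exact abs_add_le _ _

/-- Diagonal choice: taking the `n`-th competitor for the `n`-th set of an exhaustion with error `1
/ (n + 1)` yields one sequence converging in `L¹_loc(A)`. -/
theorem totalVariation_le_of_forall_compact [ProperSpace X] (hA : IsOpen A) {c : ℝ≥0∞}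
    (h : ∀ K ⊆ A, IsCompact K → ∀ ε : ℝ≥0∞, 0 < ε → ∃ (v : X → ℝ) (g : X → ℝ≥0∞),
      IsLipLocOn A v ∧ IsUpperGradientOn A v g ∧ ∫⁻ x in K, ‖v x - w x‖ₑ ∂μ ≤ ε ∧
        ∫⁻ x, g x ∂μ ≤ c) :
    totalVariation μ w A ≤ c := by
  obtain ⟨E, hEc, hEA, hEm, hE⟩ := exists_compact_exhaustion hA
  choose v g hv hg hvw hgc using fun n : ℕ => h (E n) (hEA n) (hEc n) ((n : ℝ≥0∞) + 1)⁻¹ (by simp)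
  refine (totalVariation_le_liminf hv (fun i => (hg i).isWeakUpperGradientOn) ?_).trans ?_
  · intro K hKA hK
    obtain ⟨m, hm⟩ := hE K hKA hK
    have h0 : Tendsto (fun n : ℕ => ((n : ℝ≥0∞) + 1)⁻¹) atTop (𝓝 0) := by
      have := (tendsto_add_atTop_iff_nat 1).2 ENNReal.tendsto_inv_nat_nhds_zero
      simpa using this
    refine tendsto_of_tendsto_of_tendsto_of_le_of_le' tendsto_const_nhds h0
      (Eventually.of_forall fun _ => bot_le) ?_
    filter_upwards [eventually_ge_atTop m] with n hn
    exact (lintegral_mono_set ((hm.trans interior_subset).trans (hEm hn))).trans (hvw n)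
  · refine (liminf_le_liminf (v := fun _ => c) (Eventually.of_forall fun i => ?_)).trans (by simp)
    exact (setLIntegral_le_lintegral _ _).trans (hgc i)

variable [BorelSpace X]

/-- Approximating sequences with upper gradients along all paths. -/
theorem exists_seq_of_totalVariation_lt (hA : MeasurableSet A) {c : ℝ≥0∞}
    (h : totalVariation μ w A < c) :
    ∃ (v : ℕ → X → ℝ) (g : ℕ → X → ℝ≥0∞), (∀ i, IsLipLocOn A (v i)) ∧
      (∀ i, IsUpperGradientOn A (v i) (g i)) ∧ TendstoL1Loc μ A v w ∧
      ∀ i, ∫⁻ x, g i x ∂μ < c := by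
  simp only [totalVariation, iInf_lt_iff] at h
  obtain ⟨v, g, hv, hg, hvw, hlt⟩ := h
  -- The slack `ε` below `c` pays for turning weak upper gradients into upper gradients along all
  -- paths.
  obtain ⟨ε, hε, hlt⟩ := ENNReal.lt_iff_exists_add_pos_lt.1 hlt
  have hlt' : liminf (fun i => ∫⁻ x in A, g i x ∂μ) atTop < c - ε :=
    lt_tsub_iff_right.2 hlt
  obtain ⟨n, hn, hnc⟩ := extraction_of_frequently_atTop
    (frequently_lt_of_liminf_lt (by isBoundedDefault) hlt')
  choose g' hg' hle using fun i => (hg (n i)).exists_isUpperGradientOn hA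
    (ε := (ε : ℝ≥0∞)) (by exact_mod_cast hε.ne')
  refine ⟨fun i => v (n i), g', fun i => hv _, hg', fun K hKA hK =>
    (hvw K hKA hK).comp hn.tendsto_atTop, fun i => ?_⟩
  exact (hle i).trans_lt (lt_tsub_iff_right.1 (hnc i))

theorem totalVariation_add_lipschitz_le (hA : MeasurableSet A) {f : X → ℝ} {L : ℝ≥0}
    (hf : LipschitzWith L f) :
    totalVariation μ (fun x => w x + f x) A ≤ totalVariation μ w A + L * μ A := by
  refine ENNReal.le_of_forall_pos_le_add fun ε hε hfin => ?_
  have hne : totalVariation μ w A ≠ ⊤ := (ENNReal.add_lt_top.1 hfin).1.ne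
  obtain ⟨v, g, hv, hg, hvw, hlt⟩ := exists_seq_of_totalVariation_lt hA
    (ENNReal.lt_add_right hne (b := (ε : ℝ≥0∞)) (by exact_mod_cast hε.ne'))
  refine (totalVariation_le_liminf (v := fun i x => v i x + f x)
    (fun i => (hv i).add (isLipLocOn_of_lipschitzWith hf A))
    (fun i => ((hg i).add_lipschitz hf).isWeakUpperGradientOn) ?_).trans ?_
  · intro K hKA hK
    simpa only [add_sub_add_right_eq_sub] using hvw K hKA hK
  · refine (liminf_le_liminf (v := fun _ => totalVariation μ w A + L * μ A + ε)
      (Eventually.of_forall fun i => ?_)).trans (by simp)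
    rw [lintegral_add_right _ measurable_const, setLIntegral_const]
    calc (∫⁻ x in A, g i x ∂μ) + L * μ A ≤ (totalVariation μ w A + ε) + L * μ A := by
          gcongr
          exact (setLIntegral_le_lintegral _ _).trans (hlt i).le
      _ = _ := by ring

/-- The two glued gradients carry complementary weights, so `ψ` cancels from their sum and only the
cutoff error remains, counted twice. -/
theorem lintegral_leibnizGradient_add_le {S : Set X} (hS : MeasurableSet S) {v v' ψ : X → ℝ}
    {g g' : X → ℝ≥0∞} {L : ℝ≥0} (hg : Measurable g) (hg' : Measurable g') (hψ : Continuous ψ)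
    (h01 : ∀ x, ψ x ∈ Icc (0 : ℝ) 1) :
    (∫⁻ x in U, leibnizGradient ψ S L v v' g g' x ∂μ)
        + ∫⁻ x in V, leibnizGradient ψ S L v' v g' g x ∂μ
      ≤ (∫⁻ x, g x ∂μ) + (∫⁻ x, g' x ∂μ) + 2 * (L * ∫⁻ x in S, ‖v' x - v x‖ₑ ∂μ) := by
  have hψm : Measurable fun x => ENNReal.ofReal (ψ x) := hψ.measurable.ennreal_ofReal
  have hψm' : Measurable fun x => ENNReal.ofReal (1 - ψ x) :=
    (measurable_const.sub hψ.measurable).ennreal_ofReal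
  have hsum : ∀ g g' : X → ℝ≥0∞, Measurable g → Measurable g' →
      Measurable fun x => ENNReal.ofReal (ψ x) * g' x + ENNReal.ofReal (1 - ψ x) * g x :=
    fun g g' hg hg' => (hψm.mul hg').add (hψm'.mul hg)
  have key : ∀ (v v' : X → ℝ) (g g' : X → ℝ≥0∞), Measurable g → Measurable g' →
      ∫⁻ x, leibnizGradient ψ S L v v' g g' x ∂μ
        = (∫⁻ x, (ENNReal.ofReal (ψ x) * g' x + ENNReal.ofReal (1 - ψ x) * g x) ∂μ)
          + L * ∫⁻ x in S, ‖v' x - v x‖ₑ ∂μ := by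
    intro v v' g g' hg hg'
    simp only [leibnizGradient]
    rw [lintegral_add_left (hsum g g' hg hg'), lintegral_indicator hS,
      lintegral_const_mul' _ _ ENNReal.coe_ne_top]
  refine (add_le_add (setLIntegral_le_lintegral _ _) (setLIntegral_le_lintegral _ _)).trans ?_
  rw [key v v' g g' hg hg', key v' v g' g hg' hg, add_add_add_comm,
    ← lintegral_add_left (hsum g g' hg hg'), ← lintegral_add_left hg]
  refine add_le_add (le_of_eq (lintegral_congr fun x => ?_)) (le_of_eq ?_)
  · have h1 : ENNReal.ofReal (ψ x) + ENNReal.ofReal (1 - ψ x) = 1 := by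
      rw [← ENNReal.ofReal_add (h01 x).1 (sub_nonneg.2 (h01 x).2)]; simp
    calc _ = (ENNReal.ofReal (ψ x) + ENNReal.ofReal (1 - ψ x)) * (g x + g' x) := by ring
      _ = _ := by rw [h1, one_mul]
  · rw [two_mul]
    congr 3
    refine funext fun x => ?_
    rw [← enorm_neg, neg_sub]

variable [ProperSpace X]

/-- Wherever `v` has positive weight, `w₁ = w₂`; so the error is the same convex combination of `v i
- w₂` and `v' i - w₁`, the latter felt only on `Z`. -/
theorem TendstoL1Loc.convexCombination (hU : IsOpen U) {v v' : ℕ → X → ℝ} {ψ : X → ℝ} {Z : Set X}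
    (hv : ∀ i, IsLipLocOn U (v i)) (hvw : TendstoL1Loc μ U v w₂) (hvw' : TendstoL1Loc μ V v' w₁)
    (hm₂ : AEMeasurable w₂ (μ.restrict U)) (h01 : ∀ x, ψ x ∈ Icc (0 : ℝ) 1) (hZ : IsCompact Z)
    (hZV : Z ⊆ V) (hψZ : ∀ x ∉ Z, ψ x = 0) (hw : ∀ x, ψ x ≠ 1 → w₁ x = w₂ x) :
    TendstoL1Loc μ U (fun i x => ψ x * v' i x + (1 - ψ x) * v i x) w₁ := by
  intro C hCU hC
  have hlim := (hvw C hCU hC).add (hvw' Z hZV hZ)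
  rw [add_zero] at hlim
  refine tendsto_of_tendsto_of_tendsto_of_le_of_le tendsto_const_nhds hlim
    (fun _ => bot_le) fun i => ?_
  have hpt : ∀ x, ‖ψ x * v' i x + (1 - ψ x) * v i x - w₁ x‖ₑ
      ≤ ‖v i x - w₂ x‖ₑ + Z.indicator (fun x => ‖v' i x - w₁ x‖ₑ) x := by
    intro x
    have hsplit : ψ x * v' i x + (1 - ψ x) * v i x - w₁ x
        = (1 - ψ x) * (v i x - w₂ x) + ψ x * (v' i x - w₁ x) := by
      by_cases hx : ψ x = 1
      · rw [hx]; ring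
      · rw [hw x hx]; ring
    rw [hsplit]
    refine (enorm_add_le _ _).trans (add_le_add ?_ ?_)
    · rw [enorm_mul]
      refine mul_le_of_le_one_left' ?_
      rw [← ofReal_norm, Real.norm_of_nonneg (sub_nonneg.2 (h01 x).2)]
      exact ENNReal.ofReal_le_one.2 (by linarith [(h01 x).1])
    · by_cases hx : x ∈ Z
      · rw [indicator_of_mem hx, enorm_mul]
        refine mul_le_of_le_one_left' ?_
        rw [← ofReal_norm, Real.norm_of_nonneg (h01 x).1]
        exact ENNReal.ofReal_le_one.2 (h01 x).2
      · simp [hψZ x hx]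
  refine (lintegral_mono hpt).trans ?_
  have hm : AEMeasurable (fun x => ‖v i x - w₂ x‖ₑ) (μ.restrict C) :=
    (((((hv i).continuousOn hU).mono hCU).aemeasurable hC.measurableSet).sub
      (hm₂.mono_set hCU)).enorm
  rw [lintegral_add_left' hm]
  refine add_le_add le_rfl ((setLIntegral_le_lintegral _ _).trans ?_)
  rw [lintegral_indicator hZ.measurableSet]

/-- Two functions that agree outside a compact subset of `U ∩ V`: exchanging them on `U` and `V`
does not change the sum of the total variations. -/
theorem totalVariation_add_le_of_eq_off_compact (hU : IsOpen U) (hV : IsOpen V) {K : Set X}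
    (hK : IsCompact K) (hKUV : K ⊆ U ∩ V) (hw : ∀ x ∉ K, w₁ x = w₂ x)
    (hm₁ : AEMeasurable w₁ (μ.restrict V)) (hm₂ : AEMeasurable w₂ (μ.restrict U)) :
    totalVariation μ w₁ U + totalVariation μ w₂ V
      ≤ totalVariation μ w₂ U + totalVariation μ w₁ V := by
  refine ENNReal.le_of_forall_pos_le_add fun ε hε hfin => ?_
  obtain ⟨hfin2, hfin1⟩ := ENNReal.add_lt_top.1 hfin
  have hε2 : ((ε / 2 : ℝ≥0) : ℝ≥0∞) ≠ 0 := by exact_mod_cast (half_pos hε).ne'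
  obtain ⟨v, g, hv, hg, hvw, hlt⟩ := exists_seq_of_totalVariation_lt hU.measurableSet
    (ENNReal.lt_add_right hfin2.ne hε2)
  obtain ⟨v', g', hv', hg', hvw', hlt'⟩ := exists_seq_of_totalVariation_lt hV.measurableSet
    (ENNReal.lt_add_right hfin1.ne hε2)
  obtain ⟨ψ, L, S, Z, hψ, h01, ⟨hSc, hSW, hSK, hconst⟩, ⟨hZc, hZW, hψZ⟩, hψK⟩ :=
    exists_lipschitz_cutoff hK (hU.inter hV) hKUV
  have hZU : Z ⊆ U := fun x hx => (hZW hx).1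
  have hZV : Z ⊆ V := fun x hx => (hZW hx).2
  have hSVU : S ⊆ V ∩ U := fun x hx => ⟨(hSW hx).2, (hSW hx).1⟩
  have hvm : ∀ i, ∀ C ⊆ U, IsCompact C → AEMeasurable (fun x => ‖v i x - w₂ x‖ₑ) (μ.restrict C) :=
    fun i C hCU hC => (((((hv i).continuousOn hU).mono hCU).aemeasurable hC.measurableSet).sub
      (hm₂.mono_set hCU)).enorm
  -- On `U` the approximation of `w₁` is switched in near `K`. The next step is the mirror image on
  -- `V`, with the same `ψ`, so that the weights complement each other.
  have h1 := totalVariation_le_liminf (w := w₁)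
    (fun i => (hv i).convexCombination (hv' i) hψ h01 hZc hZV hψZ)
    (fun i => IsUpperGradientOn.leibniz (μ := μ) hU hV (hv i) (hv' i) (hg i) (hg' i)
      (hlt i).ne_top (hlt' i).ne_top hψ h01 hSc.measurableSet hSW hconst hZc hZV hψZ) 
    (TendstoL1Loc.convexCombination hU hv hvw hvw' hm₂ h01 hZc hZV hψZ
      fun x hx => hw x fun hxK => hx (hψK x hxK))
  have h2 := totalVariation_le_liminf (w := w₂)
    (fun i => (hv' i).convexCombination (hv i) hψ h01 hZc hZU hψZ)
    (fun i => IsUpperGradientOn.leibniz (μ := μ) hV hU (hv' i) (hv i) (hg' i) (hg i)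
      (hlt' i).ne_top (hlt i).ne_top hψ h01 hSc.measurableSet hSVU hconst hZc hZU hψZ) 
    (TendstoL1Loc.convexCombination hV hv' hvw' hvw hm₁ h01 hZc hZU hψZ
      fun x hx => (hw x fun hxK => hx (hψK x hxK)).symm)
  -- `S` misses `K`, so both sequences converge in `L¹(S)` to the same function.
  have hSlim : Tendsto (fun i => ∫⁻ x in S, ‖v' i x - v i x‖ₑ ∂μ) atTop (𝓝 0) := by
    have hSU : S ⊆ U := fun x hx => (hSW hx).1
    have hSV : S ⊆ V := fun x hx => (hSW hx).2
    have hlim := (hvw S hSU hSc).add (hvw' S hSV hSc)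
    rw [add_zero] at hlim
    refine tendsto_of_tendsto_of_tendsto_of_le_of_le tendsto_const_nhds hlim
      (fun _ => bot_le) fun i => ?_
    beta_reduce
    rw [← lintegral_add_left' (hvm i S hSU hSc)]
    refine setLIntegral_mono' hSc.measurableSet fun x hx => ?_
    have hsplit : v' i x - v i x = (v' i x - w₁ x) - (v i x - w₂ x) := by
      rw [hw x (disjoint_left.1 hSK hx)]; ring
    rw [hsplit, add_comm]
    exact enorm_sub_le
  refine (add_le_add h1 h2).trans ((ENNReal_liminf_add_liminf_le _ _).trans ?_)
  have hlim : Tendsto (fun i => totalVariation μ w₂ U + totalVariation μ w₁ V + ε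
      + 2 * (L * ∫⁻ x in S, ‖v' i x - v i x‖ₑ ∂μ)) atTop
      (𝓝 (totalVariation μ w₂ U + totalVariation μ w₁ V + ε + 2 * (L * 0))) :=
    tendsto_const_nhds.add (ENNReal.Tendsto.const_mul
      (ENNReal.Tendsto.const_mul hSlim (Or.inr ENNReal.coe_ne_top)) (Or.inr ENNReal.ofNat_ne_top))
  rw [mul_zero, mul_zero, add_zero] at hlim
  rw [← hlim.liminf_eq]
  refine liminf_le_liminf (Eventually.of_forall fun i => ?_)
  refine (lintegral_leibnizGradient_add_le hSc.measurableSet (hg i).1 (hg' i).1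
    hψ.continuous h01).trans ?_
  gcongr ?_ + _
  have hεε : (ε : ℝ≥0∞) = (ε / 2 : ℝ≥0) + (ε / 2 : ℝ≥0) := by
    rw [← ENNReal.coe_add, add_halves]
  rw [hεε, add_add_add_comm]
  exact add_le_add (hlt i).le (hlt' i).le

end TotalVariation

/-! ### Time slices as an `L¹`-valued map -/

section Slices

theorem ae_ae_of_ae_prod_swap {α β : Type*} [MeasurableSpace α] [MeasurableSpace β]
    {ν : Measure α} {m : Measure β} [SFinite ν] [SFinite m] {p : α × β → Prop}
    (h : ∀ᵐ z ∂ν.prod m, p z) : ∀ᵐ t ∂m, ∀ᵐ x ∂ν, p (x, t) :=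
  Measure.ae_ae_of_ae_prod (p := fun z : β × α => p z.swap)
    ((Measure.measurePreserving_swap (μ := m) (ν := ν)).quasiMeasurePreserving.ae h)

theorem measurable_of_measurable_dist {α E : Type*} [MeasurableSpace α] [PseudoMetricSpace E]
    [SecondCountableTopology E] [MeasurableSpace E] [BorelSpace E] {f : α → E}
    (h : ∀ y, Measurable fun a => dist (f a) y) : Measurable f := by
  refine measurable_of_isOpen fun s hs => ?_
  have hball : ∀ y : s, ∃ r > 0, Metric.ball (y : E) r ⊆ s := fun y =>
    Metric.isOpen_iff.1 hs y y.2
  choose r hr hrs using hball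
  obtain ⟨T, hT, hTs⟩ := TopologicalSpace.isOpen_iUnion_countable
    (fun y : s => Metric.ball (y : E) (r y)) fun y => Metric.isOpen_ball
  have hs_eq : s = ⋃ y ∈ T, Metric.ball (y : E) (r y) := by
    rw [hTs]
    refine Subset.antisymm (fun y hy => mem_iUnion.2 ⟨⟨y, hy⟩, Metric.mem_ball_self (hr _)⟩)
      (iUnion_subset hrs)
  rw [hs_eq, preimage_iUnion₂]
  exact MeasurableSet.biUnion hT fun y _ => measurableSet_lt (h y) measurable_const

variable {X : Type*} [MeasurableSpace X] {ν : Measure X} {f f' : X × ℝ → ℝ} {m : Measure ℝ}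

open Classical in
/-- The slices of a function on `X × ℝ`, as elements of `L¹`; the slices that are not integrable
are replaced by `0`. -/
def sliceL1 (ν : Measure X) (f : X × ℝ → ℝ) (t : ℝ) : X →₁[ν] ℝ :=
  if h : Integrable (fun x => f (x, t)) ν then h.toL1 _ else 0

theorem sliceL1_of_integrable {t : ℝ} (h : Integrable (fun x => f (x, t)) ν) :
    sliceL1 ν f t = h.toL1 _ := dif_pos h

theorem sliceL1_of_not_integrable {t : ℝ} (h : ¬ Integrable (fun x => f (x, t)) ν) :
    sliceL1 ν f t = 0 := dif_neg h

theorem coeFn_sliceL1 {t : ℝ} (h : Integrable (fun x => f (x, t)) ν) :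
    sliceL1 ν f t =ᵐ[ν] fun x => f (x, t) := by
  rw [sliceL1_of_integrable h]
  exact h.coeFn_toL1

theorem sliceL1_congr {t : ℝ} (h : ∀ᵐ x ∂ν, f (x, t) = f' (x, t)) :
    sliceL1 ν f t = sliceL1 ν f' t := by
  by_cases hf : Integrable (fun x => f (x, t)) ν
  · have hf' : Integrable (fun x => f' (x, t)) ν := hf.congr h
    rw [sliceL1_of_integrable hf, sliceL1_of_integrable hf']
    exact (Integrable.toL1_eq_toL1_iff _ _ hf hf').2 h
  · have hf' : ¬ Integrable (fun x => f' (x, t)) ν := fun h' =>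
      hf (h'.congr (h.mono fun x hx => hx.symm))
    rw [sliceL1_of_not_integrable hf, sliceL1_of_not_integrable hf']

theorem enorm_sliceL1 {t : ℝ} (h : Integrable (fun x => f (x, t)) ν) :
    ‖sliceL1 ν f t‖ₑ = ∫⁻ x, ‖f (x, t)‖ₑ ∂ν := by
  rw [Lp.enorm_def, eLpNorm_one_eq_lintegral_enorm]
  refine lintegral_congr_ae ?_
  filter_upwards [coeFn_sliceL1 h] with x hx
  rw [hx]

theorem enorm_sliceL1_le (t : ℝ) : ‖sliceL1 ν f t‖ₑ ≤ ∫⁻ x, ‖f (x, t)‖ₑ ∂ν := by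
  by_cases h : Integrable (fun x => f (x, t)) ν
  · exact (enorm_sliceL1 h).le
  · rw [sliceL1_of_not_integrable h, enorm_zero]
    exact bot_le

theorem norm_sliceL1 {t : ℝ} (h : Integrable (fun x => f (x, t)) ν) :
    ‖sliceL1 ν f t‖ = ∫ x, ‖f (x, t)‖ ∂ν := by
  rw [← toReal_enorm, enorm_sliceL1 h, integral_norm_eq_lintegral_enorm h.aestronglyMeasurable]

theorem norm_sliceL1_sub {s t : ℝ} (hs : Integrable (fun x => f (x, s)) ν)
    (ht : Integrable (fun x => f (x, t)) ν) :
    ‖sliceL1 ν f s - sliceL1 ν f t‖ = ∫ x, ‖f (x, s) - f (x, t)‖ ∂ν := by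
  rw [sliceL1_of_integrable hs, sliceL1_of_integrable ht, ← Integrable.toL1_sub,
    L1.norm_eq_integral_norm]
  refine integral_congr_ae ?_
  filter_upwards [(hs.sub ht).coeFn_toL1] with x hx
  rw [hx, Pi.sub_apply]

theorem secondCountableTopology_L1 [IsSeparable ν] : SecondCountableTopology (X →₁[ν] ℝ) := by
  have : Fact ((1 : ℝ≥0∞) ≠ ⊤) := ⟨ENNReal.one_ne_top⟩
  infer_instance

variable [SFinite ν]

/-- The distance is `∫ |f(·, t) - v|`, measurable in `t` by Tonelli, on the measurable set of times
with integrable slice; elsewhere it is constant. In a separable target, distances to points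
determine measurability. -/
theorem measurable_dist_sliceL1 (hf : StronglyMeasurable f) (v : X →₁[ν] ℝ) :
    Measurable fun t => dist (sliceL1 ν f t) v := by
  classical
  have hvm : Measurable (v : X → ℝ) := (Lp.stronglyMeasurable v).measurable
  have hset : MeasurableSet {t : ℝ | Integrable (fun x => f (x, t)) ν} :=
    measurableSet_integrable (f := fun (t : ℝ) (x : X) => f (x, t))
      (hf.comp_measurable measurable_swap)
  have hcompare : ∀ t, Integrable (fun x => f (x, t)) ν →
      dist (sliceL1 ν f t) v = (∫⁻ x, ‖f (x, t) - v x‖ₑ ∂ν).toReal := by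
    intro t ht
    rw [dist_edist, Lp.edist_def, eLpNorm_one_eq_lintegral_enorm]
    congr 1
    refine lintegral_congr_ae ?_
    filter_upwards [coeFn_sliceL1 ht] with x hx
    rw [Pi.sub_apply, hx]
  have heq : (fun t => dist (sliceL1 ν f t) v) = fun t =>
      {t : ℝ | Integrable (fun x => f (x, t)) ν}.piecewise
        (fun t => (∫⁻ x, ‖f (x, t) - v x‖ₑ ∂ν).toReal) (fun _ => dist 0 v) t := by
    funext t
    by_cases ht : Integrable (fun x => f (x, t)) ν
    · rw [piecewise_eq_of_mem _ _ _ (show t ∈ {t : ℝ | Integrable (fun x => f (x, t)) ν} from ht),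
        hcompare t ht]
    · rw [piecewise_eq_of_notMem _ _ _ (show t ∉ {t : ℝ | Integrable (fun x => f (x, t)) ν} from ht),
        sliceL1_of_not_integrable ht]
  rw [heq]
  refine Measurable.piecewise hset (Measurable.ennreal_toReal ?_) measurable_const
  exact Measurable.lintegral_prod_left'
    (f := fun p : X × ℝ => ‖f p - v p.1‖ₑ) (hf.measurable.sub (hvm.comp measurable_fst)).enorm

theorem aestronglyMeasurable_sliceL1 [IsSeparable ν] [SFinite m]
    (hf : AEStronglyMeasurable f (ν.prod m)) :
    AEStronglyMeasurable (sliceL1 ν f) m := by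
  have := secondCountableTopology_L1 (ν := ν)
  let _ : MeasurableSpace (X →₁[ν] ℝ) := borel _
  have : BorelSpace (X →₁[ν] ℝ) := ⟨rfl⟩
  refine ⟨sliceL1 ν (hf.mk f), ?_, ?_⟩
  · exact (measurable_of_measurable_dist
      fun v => measurable_dist_sliceL1 hf.stronglyMeasurable_mk v).stronglyMeasurable
  · filter_upwards [ae_ae_of_ae_prod_swap hf.ae_eq_mk] with t ht
    exact sliceL1_congr ht

end Slices

/-! ### Lower semicontinuity of total variation and measurability in time -/

section TotalVariationMeasurable

variable {X : Type*} [MetricSpace X] [ProperSpace X] [MeasurableSpace X] [BorelSpace X]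
  {μ : Measure X} {A : Set X}

/-- Sublevel sets are sequentially closed: a good approximation on `K` of some `w n` close to `w₀`
also approximates `w₀` on `K`. -/
theorem lowerSemicontinuous_totalVariation (hA : IsOpen A) :
    LowerSemicontinuous fun w : X →₁[μ.restrict A] ℝ => totalVariation μ w A := by
  rw [lowerSemicontinuous_iff_isClosed_preimage]
  intro c
  refine IsSeqClosed.isClosed fun w w₀ hw hlim => ?_
  change totalVariation μ w₀ A ≤ c
  refine ENNReal.le_of_forall_pos_le_add fun ε hε hc => ?_
  refine totalVariation_le_of_forall_compact hA fun K hKA hK η hη => ?_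
  have hη2 : 0 < η / 2 := ENNReal.half_pos hη.ne'
  have hlim' : ∀ᶠ n in atTop, edist (w n) w₀ < η / 2 :=
    (tendsto_iff_edist_tendsto_0.1 hlim).eventually_lt_const hη2
  obtain ⟨n, hn⟩ := hlim'.exists
  have hwn : totalVariation μ (w n) A < c + ε :=
    lt_of_le_of_lt (hw n) (ENNReal.lt_add_right hc.ne (by exact_mod_cast hε.ne'))
  obtain ⟨v, g, hv, hg, hvw, hlt⟩ := exists_seq_of_totalVariation_lt hA.measurableSet hwn
  obtain ⟨i, hi⟩ := ((hvw K hKA hK).eventually_lt_const hη2).exists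
  refine ⟨v i, g i, hv i, hg i, ?_, (hlt i).le⟩
  have hm : Measurable fun x => ‖w n x - w₀ x‖ₑ :=
    ((Lp.stronglyMeasurable (w n)).measurable.sub (Lp.stronglyMeasurable w₀).measurable).enorm
  calc ∫⁻ x in K, ‖v i x - w₀ x‖ₑ ∂μ
      ≤ ∫⁻ x in K, (‖v i x - w n x‖ₑ + ‖w n x - w₀ x‖ₑ) ∂μ := by
        refine lintegral_mono fun x => ?_
        rw [← sub_add_sub_cancel (v i x) (w n x) (w₀ x)]
        exact enorm_add_le _ _
    _ = (∫⁻ x in K, ‖v i x - w n x‖ₑ ∂μ) + ∫⁻ x in K, ‖w n x - w₀ x‖ₑ ∂μ :=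
        lintegral_add_right _ hm
    _ ≤ η / 2 + η / 2 := by
        refine add_le_add hi.le (le_trans ?_ hn.le)
        rw [Lp.edist_def, eLpNorm_one_eq_lintegral_enorm]
        exact lintegral_mono_set hKA
    _ = η := ENNReal.add_halves η

variable [IsLocallyFiniteMeasure μ]

/-- The total variation of the slices of a function is a measurable function of time. -/
theorem aemeasurable_totalVariation_slice (hA : IsOpen A) {f : X × ℝ → ℝ} {m : Measure ℝ}
    [SFinite m] (hf : AEStronglyMeasurable f ((μ.restrict A).prod m))
    (hint : ∀ᵐ t ∂m, Integrable (fun x => f (x, t)) (μ.restrict A)) :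
    AEMeasurable (fun t => totalVariation μ (fun x => f (x, t)) A) m := by
  let _ : MeasurableSpace (X →₁[μ.restrict A] ℝ) := borel _
  have : BorelSpace (X →₁[μ.restrict A] ℝ) := ⟨rfl⟩
  have h1 := (lowerSemicontinuous_totalVariation (μ := μ) hA).measurable.comp_aemeasurable
    (aestronglyMeasurable_sliceL1 hf).aemeasurable
  refine h1.congr ?_
  filter_upwards [hint] with t ht
  exact totalVariation_congr_ae (coeFn_sliceL1 ht)

end TotalVariationMeasurable

/-! ### Lebesgue points of the slice map -/

section LebesguePoints

/-- One-sided averages converge at points of Lebesgue type. -/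
theorem tendsto_average_of_tendsto_majorant {m D : ℝ → ℝ} {t a b C : ℝ} (hab : t ∈ Ioo a b)
    (hm : IntegrableOn m (Ioo a b)) (hD : IntegrableOn D (Ioo a b)) (hD0 : ∀ s, 0 ≤ D s)
    (hC : 0 ≤ C)
    (hle : ∀ᵐ s, s ∈ Ioo a b → |s - t| ≤ 1 → |m s - m t| ≤ C * (D s + |s - t|))
    (hlim : Tendsto (fun δ => δ⁻¹ * ∫ s in Metric.closedBall t δ, D s) (𝓝[>] 0) (𝓝 0))
    {J : ℝ → Set ℝ} (hJ : ∀ h, J h ⊆ Metric.closedBall t h) (hJm : ∀ h, MeasurableSet (J h))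
    (hJv : ∀ h, volume (J h) = ENNReal.ofReal h) :
    Tendsto (fun h => h⁻¹ * ∫ s in J h, m s) (𝓝[>] 0) (𝓝 (m t)) := by
  have hbound : Tendsto (fun h : ℝ => C * (h⁻¹ * ∫ s in Metric.closedBall t h, D s) + C * (2 * h))
      (𝓝[>] 0) (𝓝 0) := by
    have h2 : Tendsto (fun h : ℝ => C * (2 * h)) (𝓝[>] 0) (𝓝 (C * (2 * 0))) :=
      ((continuous_const.mul (continuous_const.mul continuous_id)).tendsto 0).mono_left
        nhdsWithin_le_nhds
    simpa using (hlim.const_mul C).add h2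
  rw [tendsto_iff_dist_tendsto_zero]
  refine squeeze_zero' (Eventually.of_forall fun _ => dist_nonneg) ?_ hbound
  have hsmall : ∀ᶠ h : ℝ in 𝓝[>] 0, h < min 1 (min (t - a) (b - t)) :=
    nhdsWithin_le_nhds (eventually_lt_nhds (lt_min one_pos (lt_min (sub_pos.2 hab.1)
      (sub_pos.2 hab.2))))
  filter_upwards [hsmall, self_mem_nhdsWithin] with h hh hpos
  replace hpos : 0 < h := hpos
  have hball : Metric.closedBall t h ⊆ Ioo a b := by
    intro s hs
    rw [Real.closedBall_eq_Icc] at hs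
    have h1 : h < t - a := hh.trans_le ((min_le_right _ _).trans (min_le_left _ _))
    have h2 : h < b - t := hh.trans_le ((min_le_right _ _).trans (min_le_right _ _))
    exact ⟨by linarith [hs.1], by linarith [hs.2]⟩
  have hJab : J h ⊆ Ioo a b := (hJ h).trans hball
  have hJr : volume.real (J h) = h := by
    rw [Measure.real, hJv, ENNReal.toReal_ofReal hpos.le]
  have hJfin : volume (J h) ≠ ⊤ := by rw [hJv]; exact ENNReal.ofReal_ne_top
  have hconst : IntegrableOn (fun _ : ℝ => m t) (J h) := integrableOn_const hJfin
  have heq : h⁻¹ * (∫ s in J h, m s) - m t = h⁻¹ * ∫ s in J h, (m s - m t) := by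
    rw [integral_sub (hm.mono_set hJab) hconst, setIntegral_const, hJr, smul_eq_mul]
    field_simp
  rw [Real.dist_eq, heq, abs_mul, abs_of_pos (inv_pos.2 hpos)]
  have hballfin : volume (Metric.closedBall t h) ≠ ⊤ := measure_closedBall_lt_top.ne
  have hint : IntegrableOn (fun s => C * (D s + h)) (Metric.closedBall t h) :=
    ((hD.mono_set hball).add (integrableOn_const hballfin)).const_mul C
  calc h⁻¹ * |∫ s in J h, (m s - m t)| ≤ h⁻¹ * ∫ s in J h, |m s - m t| := by
        gcongr; exact abs_integral_le_integral_abs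
    _ ≤ h⁻¹ * ∫ s in J h, C * (D s + h) := by
        gcongr ?_ * ?_
        refine setIntegral_mono_on_ae (((hm.mono_set hJab).sub hconst).abs) (hint.mono_set (hJ h))
          (hJm h) ?_
        filter_upwards [hle] with s hs hsJ
        have hst : |s - t| ≤ h := by
          have := hJ h hsJ
          rwa [Metric.mem_closedBall, Real.dist_eq] at this
        refine (hs (hJab hsJ) (hst.trans (hh.le.trans (min_le_left _ _)))).trans ?_
        gcongr
    -- Passing from the one-sided `J h` to the symmetric ball is harmless because the majorant is
    -- nonnegative.
    _ ≤ h⁻¹ * ∫ s in Metric.closedBall t h, C * (D s + h) := by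
        gcongr ?_ * ?_
        refine setIntegral_mono_set hint (Eventually.of_forall fun s => ?_) (hJ h).eventuallyLE
        exact mul_nonneg hC (add_nonneg (hD0 s) hpos.le)
    _ = C * (h⁻¹ * ∫ s in Metric.closedBall t h, D s) + C * (2 * h) := by
        rw [integral_const_mul, integral_add (hD.mono_set hball) (integrableOn_const hballfin),
          setIntegral_const, Real.volume_real_closedBall hpos.le, smul_eq_mul]
        field_simp

variable {X : Type*} [MetricSpace X] [MeasurableSpace X] {μ : Measure X}
  {Ω Ω' A : Set X} {T a b : ℝ} {u : X × ℝ → ℝ}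

/-- `t` is a Lebesgue point of the slices of `u` in `L¹(A)`. -/
def IsSliceLebesguePoint (μ : Measure X) (A : Set X) (u : X × ℝ → ℝ) (t : ℝ) : Prop :=
  Integrable (fun x => u (x, t)) (μ.restrict A) ∧
    Tendsto (fun δ => δ⁻¹ * ∫ s in Metric.closedBall t δ,
      ‖sliceL1 (μ.restrict A) u s - sliceL1 (μ.restrict A) u t‖) (𝓝[>] 0) (𝓝 0)

theorem MemL1LocBVLoc.timeTotalVariation_lt_top (hu : MemL1LocBVLoc μ Ω T u)
    (hA : CompactlyInside A Ω) (ha : 0 < a) (hab : a < b) (hb : b < T) :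
    timeTotalVariation μ u A a b < ⊤ :=
  (lintegral_mono fun _ => le_add_self).trans_lt (hu.lintegral_lt_top A hA a b ha hab hb)

variable [SFinite μ]

theorem MemL1LocBVLoc.aestronglyMeasurable_prod (hu : MemL1LocBVLoc μ Ω T u)
    (hA : A ⊆ Ω) (ha : 0 ≤ a) (hb : b ≤ T) :
    AEStronglyMeasurable u ((μ.restrict A).prod (volume.restrict (Ioo a b))) := by
  rw [Measure.prod_restrict]
  exact hu.aestronglyMeasurable.mono_set (prod_mono hA (Ioo_subset_Ioo ha hb))

theorem MemL1LocBVLoc.integrable_prod (hu : MemL1LocBVLoc μ Ω T u)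
    (hA : CompactlyInside A Ω) (ha : 0 < a) (hab : a < b) (hb : b < T) :
    Integrable u ((μ.restrict A).prod (volume.restrict (Ioo a b))) := by
  have hm := hu.aestronglyMeasurable_prod (subset_closure.trans hA.2.2) ha.le hb.le
  refine ⟨hm, ?_⟩
  rw [hasFiniteIntegral_iff_enorm, lintegral_prod_symm _ hm.enorm]
  exact (lintegral_mono fun _ => le_self_add).trans_lt (hu.lintegral_lt_top A hA a b ha hab hb)

theorem MemL1LocBVLoc.ae_integrable (hu : MemL1LocBVLoc μ Ω T u)
    (hA : CompactlyInside A Ω) (ha : 0 < a) (hab : a < b) (hb : b < T) :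
    ∀ᵐ t ∂volume.restrict (Ioo a b), Integrable (fun x => u (x, t)) (μ.restrict A) :=
  (hu.integrable_prod hA ha hab hb).prod_left_ae

theorem MemL1LocBVLoc.integrable_prod_mul (hu : MemL1LocBVLoc μ Ω T u)
    (hA : CompactlyInside A Ω) (ha : 0 < a) (hab : a < b) (hb : b < T) {ψ : X × ℝ → ℝ}
    (hψ : Measurable ψ) {M : ℝ} (hM : ∀ p, |ψ p| ≤ M) :
    Integrable (fun p => u p * ψ p) ((μ.restrict A).prod (volume.restrict (Ioo a b))) :=
  (hu.integrable_prod hA ha hab hb).mul_bdd hψ.aestronglyMeasurable (Eventually.of_forall hM)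

variable [IsSeparable (μ.restrict A)]

theorem MemL1LocBVLoc.integrableOn_sliceL1 (hu : MemL1LocBVLoc μ Ω T u)
    (hA : CompactlyInside A Ω) (ha : 0 < a) (hab : a < b) (hb : b < T) :
    IntegrableOn (sliceL1 (μ.restrict A) u) (Ioo a b) := by
  have h := hu.integrable_prod hA ha hab hb
  refine ⟨aestronglyMeasurable_sliceL1 h.aestronglyMeasurable, ?_⟩
  rw [hasFiniteIntegral_iff_enorm]
  refine (lintegral_mono fun t => enorm_sliceL1_le t).trans_lt ?_
  rw [← lintegral_prod_symm _ h.aestronglyMeasurable.enorm]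
  exact h.2

theorem MemL1LocBVLoc.ae_isSliceLebesguePoint (hu : MemL1LocBVLoc μ Ω T u)
    (hA : CompactlyInside A Ω) (ha : 0 < a) (hab : a < b) (hb : b < T) :
    ∀ᵐ t, t ∈ Ioo a b → IsSliceLebesguePoint μ A u t := by
  have hint := hu.integrableOn_sliceL1 hA ha hab hb
  have hLeb := IsUnifLocDoublingMeasure.ae_tendsto_average_norm_sub (volume : Measure ℝ)
    ((integrable_indicator_iff measurableSet_Ioo).2 hint).locallyIntegrable 1
  have hslice := hu.ae_integrable hA ha hab hb
  rw [ae_restrict_iff' measurableSet_Ioo] at hslice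
  filter_upwards [hLeb, hslice] with t h1 h2 ht
  refine ⟨h2 ht, ?_⟩
  have h3 := h1 (l := 𝓝[>] (0 : ℝ)) (fun _ => t) (fun δ => δ) tendsto_id (by
    filter_upwards [self_mem_nhdsWithin] with δ hδ
    exact Metric.mem_closedBall_self (by rw [one_mul]; exact le_of_lt hδ))
  -- The average divides by the length `2 * δ` of the ball, whereas the Lebesgue point condition
  -- divides by `δ`.
  have h4 := h3.const_mul 2
  rw [mul_zero] at h4
  refine h4.congr' ?_
  have hsmall : ∀ᶠ δ : ℝ in 𝓝[>] 0, Metric.closedBall t δ ⊆ Ioo a b := by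
    obtain ⟨ε, hε, hsub⟩ := Metric.nhds_basis_closedBall.mem_iff.1 (Ioo_mem_nhds ht.1 ht.2)
    filter_upwards [nhdsWithin_le_nhds (Iio_mem_nhds hε)] with δ hδ
    exact (Metric.closedBall_subset_closedBall (le_of_lt hδ)).trans hsub
  filter_upwards [hsmall, self_mem_nhdsWithin] with δ hδ hpos
  replace hpos : 0 < δ := hpos
  rw [setAverage_eq, Real.volume_real_closedBall hpos.le, smul_eq_mul, mul_inv, ← mul_assoc,
    ← mul_assoc, mul_inv_cancel₀ two_ne_zero, one_mul]
  congr 1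
  refine setIntegral_congr_fun Metric.isClosed_closedBall.measurableSet fun s hs => ?_
  rw [indicator_of_mem (hδ hs), indicator_of_mem ht]

end LebesguePoints

/-! ### The exceptional null set of times -/

section NullSet

variable {X : Type*} [MetricSpace X] [ProperSpace X] [MeasurableSpace X] [BorelSpace X]
  {μ : Measure X} [IsLocallyFiniteMeasure μ] {Ω A : Set X} {T a b t : ℝ} {u φ : X × ℝ → ℝ}

/-- One null set serves all `A` because countably many sets and time intervals suffice: the closure
of `A` lies in the interior of some member of a compact exhaustion. Hence the larger set `A'`. -/
theorem MemL1LocBVLoc.exists_null_set (hu : MemL1LocBVLoc μ Ω T u) (hΩ : IsOpen Ω) (hT : 0 < T) :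
    ∃ N : Set ℝ, volume N = 0 ∧ ∀ t ∈ Ioo 0 T, t ∉ N → ∀ A, CompactlyInside A Ω →
      ∃ A', CompactlyInside A' Ω ∧ A ⊆ A' ∧ IsSliceLebesguePoint μ A' u t := by
  obtain ⟨E, hEc, hEΩ, -, hE⟩ := exists_compact_exhaustion hΩ
  have hin : ∀ n, CompactlyInside (interior (E n)) Ω := fun n =>
    have hcl : closure (interior (E n)) ⊆ E n :=
      closure_minimal interior_subset (hEc n).isClosed
    ⟨isOpen_interior, (hEc n).of_isClosed_subset isClosed_closure hcl, hcl.trans (hEΩ n)⟩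
  -- The shift by `3` makes the interval from `T / (j + 3)` to `T - T / (j + 3)` nonempty already
  -- for `j = 0`.
  have hpos : ∀ j : ℕ, 0 < T / (j + 3) := fun j => by positivity
  have hlt : ∀ j : ℕ, T / (j + 3) < T - T / (j + 3) := fun j => by
    have : T / ((j : ℝ) + 3) ≤ T / 3 := by gcongr; linarith [(Nat.cast_nonneg j : (0 : ℝ) ≤ j)]
    linarith
  have hae : ∀ᵐ t, ∀ n j : ℕ, t ∈ Ioo (T / ((j : ℝ) + 3)) (T - T / (j + 3)) →
      IsSliceLebesguePoint μ (interior (E n)) u t := by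
    rw [ae_all_iff]
    intro n
    rw [ae_all_iff]
    intro j
    exact hu.ae_isSliceLebesguePoint (hin n) (hpos j) (hlt j) (by linarith [hpos j])
  refine ⟨_, hae, fun t ht htN A hA => ?_⟩
  obtain ⟨n, hn⟩ := hE _ hA.2.2 hA.2.1
  have hlim : Tendsto (fun j : ℕ => T / ((j : ℝ) + 3)) atTop (𝓝 0) :=
    Tendsto.div_atTop tendsto_const_nhds
      (tendsto_atTop_add_const_right _ _ tendsto_natCast_atTop_atTop)
  obtain ⟨j, hj⟩ := (hlim.eventually_lt_const (lt_min ht.1 (sub_pos.2 ht.2))).exists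
  refine ⟨interior (E n), hin n, subset_closure.trans hn, not_not.1 htN n j ⟨?_, ?_⟩⟩
  · exact hj.trans_le (min_le_left _ _)
  · linarith [hj.trans_le (min_le_right _ _)]

/-- At Lebesgue points, the averages of `∫ u φ` converge. -/
theorem MemL1LocBVLoc.tendsto_average_integral_mul (hu : MemL1LocBVLoc μ Ω T u)
    (hA : CompactlyInside A Ω) (ht : t ∈ Ioo 0 T) (hLeb : IsSliceLebesguePoint μ A u t)
    {L M : ℝ≥0} (hφ : LipschitzWith L φ) (hM : ∀ p, |φ p| ≤ M)
    {J : ℝ → Set ℝ} (hJ : ∀ h, J h ⊆ Metric.closedBall t h) (hJm : ∀ h, MeasurableSet (J h))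
    (hJv : ∀ h, volume (J h) = ENNReal.ofReal h) :
    Tendsto (fun h => h⁻¹ * ∫ s in J h, ∫ x in A, u (x, s) * φ (x, s) ∂μ) (𝓝[>] 0)
      (𝓝 (∫ x in A, u (x, t) * φ (x, t) ∂μ)) := by
  obtain ⟨a, ha, hat⟩ := exists_between ht.1
  obtain ⟨b, htb, hb⟩ := exists_between ht.2
  have hab : a < b := hat.trans htb
  obtain ⟨hti, hlim⟩ := hLeb
  have hslice := hu.integrableOn_sliceL1 hA ha hab hb
  have hD : IntegrableOn (fun s => ‖sliceL1 (μ.restrict A) u s - sliceL1 (μ.restrict A) u t‖)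
      (Ioo a b) := (hslice.sub (integrableOn_const measure_Ioo_lt_top.ne)).norm
  -- Of `φ` only the bound `M` and the Lipschitz constant `L` enter the majorant, so a Lebesgue
  -- point of the slices works for every `φ`.
  refine tendsto_average_of_tendsto_majorant (C := M + L + L * ‖sliceL1 (μ.restrict A) u t‖)
    ⟨hat, htb⟩
    (hu.integrable_prod_mul hA ha hab hb hφ.continuous.measurable hM).integral_prod_right
    hD (fun _ => norm_nonneg _) (by positivity) ?_ hlim hJ hJm hJv
  have hae := hu.ae_integrable hA ha hab hb
  rw [ae_restrict_iff' measurableSet_Ioo] at hae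
  filter_upwards [hae] with s hs hsab hst
  have hsi := hs hsab
  have hφm : ∀ r, AEStronglyMeasurable (fun x => φ (x, r)) (μ.restrict A) := fun r =>
    (hφ.continuous.comp (by fun_prop : Continuous fun x : X => (x, r))).aestronglyMeasurable
  have hmul : ∀ r, Integrable (fun x => u (x, r)) (μ.restrict A) →
      Integrable (fun x => u (x, r) * φ (x, r)) (μ.restrict A) := fun r hr =>
    hr.mul_bdd (hφm r) (Eventually.of_forall fun x => hM _)
  have hpt : ∀ x, |u (x, s) * φ (x, s) - u (x, t) * φ (x, t)|
      ≤ (M + L) * ‖u (x, s) - u (x, t)‖ + L * |s - t| * ‖u (x, t)‖ := by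
    intro x
    have h1 : |φ (x, s) - φ (x, t)| ≤ L * |s - t| := by
      have := hφ.dist_le_mul (x, s) (x, t)
      rwa [dist_prod_same_left, Real.dist_eq, Real.dist_eq] at this
    have h2 : |φ (x, s) - φ (x, t)| ≤ L := h1.trans (mul_le_of_le_one_right L.coe_nonneg hst)
    have h3 : u (x, s) * φ (x, s) - u (x, t) * φ (x, t)
        = (u (x, s) - u (x, t)) * φ (x, t) + (u (x, s) - u (x, t)) * (φ (x, s) - φ (x, t))
          + u (x, t) * (φ (x, s) - φ (x, t)) := by ring
    rw [h3, Real.norm_eq_abs, Real.norm_eq_abs]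
    refine (abs_add_three _ _ _).trans ?_
    rw [abs_mul, abs_mul, abs_mul]
    have e1 := mul_le_mul_of_nonneg_left (hM (x, t)) (abs_nonneg (u (x, s) - u (x, t)))
    have e2 := mul_le_mul_of_nonneg_left h2 (abs_nonneg (u (x, s) - u (x, t)))
    have e3 := mul_le_mul_of_nonneg_left h1 (abs_nonneg (u (x, t)))
    linarith
  rw [← integral_sub (hmul s hsi) (hmul t hti)]
  refine abs_integral_le_integral_abs.trans ?_
  have hi₁ : Integrable (fun x => (M + L : ℝ) * ‖u (x, s) - u (x, t)‖) (μ.restrict A) :=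
    (hsi.sub hti).norm.const_mul _
  have hi₂ : Integrable (fun x => L * |s - t| * ‖u (x, t)‖) (μ.restrict A) :=
    hti.norm.const_mul _
  refine (integral_mono ((hmul s hsi).sub (hmul t hti)).abs (hi₁.add hi₂) hpt).trans ?_
  rw [integral_add' hi₁ hi₂, integral_const_mul, integral_const_mul,
    ← norm_sliceL1_sub hsi hti, ← norm_sliceL1 hti]
  set D := ‖sliceL1 (μ.restrict A) u s - sliceL1 (μ.restrict A) u t‖
  set B := ‖sliceL1 (μ.restrict A) u t‖
  have hD0 : 0 ≤ D := norm_nonneg _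
  have hB0 : 0 ≤ B := norm_nonneg _
  have hst0 : 0 ≤ |s - t| := abs_nonneg _
  have hL0 : (0 : ℝ) ≤ L := L.coe_nonneg
  have e1 : 0 ≤ L * B * D := by positivity
  have e2 : 0 ≤ (M + L) * |s - t| := by positivity
  nlinarith

end NullSet

/-! ### Localizing the variational inequality -/

section Localization

variable {X : Type*} [MetricSpace X]

theorem timeDeriv_eq_zero_of_notMem_tsupport {φ : X × ℝ → ℝ} {x : X} {t : ℝ}
    (h : (x, t) ∉ tsupport φ) : timeDeriv φ x t = 0 := by
  have h1 : ∀ᶠ s in 𝓝 t, φ (x, s) = 0 :=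
    (by fun_prop : Continuous fun s : ℝ => (x, s)).continuousAt.eventually
      (notMem_tsupport_iff_eventuallyEq.1 h)
  have h2 : (fun s => φ (x, s)) =ᶠ[𝓝 t] fun _ => 0 := h1
  rw [timeDeriv, h2.deriv_eq, deriv_const]

theorem lipschitzWith_slice {φ : X × ℝ → ℝ} {L : ℝ≥0} (hφ : LipschitzWith L φ) (t : ℝ) :
    LipschitzWith L fun x => φ (x, t) :=
  LipschitzWith.of_dist_le_mul fun x y => by
    have := hφ.dist_le_mul (x, t) (y, t)
    rwa [dist_prod_same_right] at this

theorem IsTestFunction.mono {A B : Set X} {s₁ s₂ : ℝ} {φ : X × ℝ → ℝ}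
    (hφ : IsTestFunction A s₁ s₂ φ) (hAB : A ⊆ B) : IsTestFunction B s₁ s₂ φ :=
  ⟨hφ.lipschitz, hφ.hasCompactSupport, hφ.tsupport_subset.trans (prod_mono hAB subset_rfl)⟩

theorem IsTestFunction.continuous {A : Set X} {s₁ s₂ : ℝ} {φ : X × ℝ → ℝ}
    (hφ : IsTestFunction A s₁ s₂ φ) : Continuous φ :=
  let ⟨_, hL⟩ := hφ.lipschitz
  hL.continuous

theorem IsTestFunction.exists_bound {A : Set X} {s₁ s₂ : ℝ} {φ : X × ℝ → ℝ}
    (hφ : IsTestFunction A s₁ s₂ φ) : ∃ M : ℝ≥0, ∀ p, |φ p| ≤ M := by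
  obtain ⟨C, hC⟩ := hφ.hasCompactSupport.exists_bound_of_continuous hφ.continuous
  exact ⟨C.toNNReal, fun p => (hC p).trans (Real.le_coe_toNNReal C)⟩

theorem IsTestFunction.isCompact_image_fst {A : Set X} {s₁ s₂ : ℝ} {φ : X × ℝ → ℝ}
    (hφ : IsTestFunction A s₁ s₂ φ) : IsCompact (Prod.fst '' tsupport φ) :=
  IsCompact.image hφ.hasCompactSupport continuous_fst

theorem eq_zero_of_notMem_image_fst_tsupport {φ : X × ℝ → ℝ} {x : X}
    (hx : x ∉ Prod.fst '' tsupport φ) (t : ℝ) : φ (x, t) = 0 :=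
  image_eq_zero_of_notMem_tsupport fun h => hx ⟨(x, t), h, rfl⟩

variable [MeasurableSpace X] {μ : Measure X} {Ω A : Set X} {T a b : ℝ} {u φ : X × ℝ → ℝ}

/-- The integrand vanishes off the support of `φ`, so the derivative term is the same on every
cylinder containing that support. -/
theorem integral_mul_timeDeriv_eq_of_tsupport_subset {U : Set X} {I : Set ℝ}
    (h : tsupport φ ⊆ U ×ˢ I) :
    ∫ t in I, ∫ x in U, -(u (x, t) * timeDeriv φ x t) ∂μ
      = ∫ t, ∫ x, -(u (x, t) * timeDeriv φ x t) ∂μ := by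
  have hz : ∀ x t, ¬ (x ∈ U ∧ t ∈ I) → -(u (x, t) * timeDeriv φ x t) = 0 := by
    intro x t hxt
    rw [timeDeriv_eq_zero_of_notMem_tsupport fun hmem => hxt (h hmem), mul_zero, neg_zero]
  have h1 : ∀ t, ∫ x in U, -(u (x, t) * timeDeriv φ x t) ∂μ
      = ∫ x, -(u (x, t) * timeDeriv φ x t) ∂μ := fun t =>
    setIntegral_eq_integral_of_forall_compl_eq_zero fun x hx => hz x t fun hxt => hx hxt.1
  simp only [h1]
  refine setIntegral_eq_integral_of_forall_compl_eq_zero fun t ht => ?_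
  rw [← integral_zero X ℝ (μ := μ)]
  exact integral_congr_ae (Eventually.of_forall fun x => hz x t fun hxt => ht hxt.2)

theorem CompactlyInside.measure_lt_top [IsLocallyFiniteMeasure μ] (hA : CompactlyInside A Ω) :
    μ A < ⊤ :=
  (measure_mono subset_closure).trans_lt hA.2.1.measure_lt_top

variable [BorelSpace X]

theorem timeTotalVariation_add_lipschitz_le (hA : MeasurableSet A) {L : ℝ≥0}
    (hφ : LipschitzWith L φ) :
    timeTotalVariation μ (u + φ) A a b
      ≤ timeTotalVariation μ u A a b + L * μ A * ENNReal.ofReal (b - a) := by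
  refine (lintegral_mono fun t =>
    totalVariation_add_lipschitz_le hA (lipschitzWith_slice hφ t)).trans ?_
  rw [lintegral_add_right _ measurable_const, setLIntegral_const, Real.volume_Ioo,
    timeTotalVariation]

theorem MemL1LocBVLoc.timeTotalVariation_add_lt_top [IsLocallyFiniteMeasure μ]
    (hu : MemL1LocBVLoc μ Ω T u)
    (hA : CompactlyInside A Ω) (ha : 0 < a) (hab : a < b) (hb : b < T) {L : ℝ≥0}
    (hφ : LipschitzWith L φ) : timeTotalVariation μ (u + φ) A a b < ⊤ :=
  (timeTotalVariation_add_lipschitz_le hA.1.measurableSet hφ).trans_lt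
    (ENNReal.add_lt_top.2 ⟨hu.timeTotalVariation_lt_top hA ha hab hb,
      ENNReal.mul_lt_top (ENNReal.mul_lt_top ENNReal.coe_lt_top hA.measure_lt_top)
        ENNReal.ofReal_lt_top⟩)

variable [ProperSpace X] [IsLocallyFiniteMeasure μ]

theorem MemL1LocBVLoc.aemeasurable_totalVariation_add (hu : MemL1LocBVLoc μ Ω T u)
    (hA : CompactlyInside A Ω) (ha : 0 < a) (hab : a < b) (hb : b < T)
    {B : Set X} {s₁ s₂ : ℝ} (hφ : IsTestFunction B s₁ s₂ φ) :
    AEMeasurable (fun t => totalVariation μ (fun x => (u + φ) (x, t)) A)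
      (volume.restrict (Ioo a b)) := by
  refine aemeasurable_totalVariation_slice hA.1
    ((hu.aestronglyMeasurable_prod (subset_closure.trans hA.2.2) ha.le hb.le).add
      hφ.continuous.aestronglyMeasurable) ?_
  filter_upwards [hu.ae_integrable hA ha hab hb] with t ht
  refine ht.add (Continuous.integrable_of_hasCompactSupport ?_ ?_).integrableOn
  · exact hφ.continuous.comp (by fun_prop)
  · exact HasCompactSupport.intro hφ.isCompact_image_fst
      fun x hx => eq_zero_of_notMem_image_fst_tsupport hx t

/-- The variational inequality, localized to a cylinder. -/
theorem IsVariationalSolution.localized (hu : IsVariationalSolution μ Ω T u)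
    (hA : CompactlyInside A Ω) (ha : 0 < a) (hab : a < b) (hb : b < T)
    (hφ : IsTestFunction A 0 T φ) (hφ0 : ∀ x, ∀ t ∉ Ioo a b, φ (x, t) = 0) :
    (∫ t in Ioo a b, ∫ x in A, -(u (x, t) * timeDeriv φ x t) ∂μ)
        + (timeTotalVariation μ u A a b).toReal
      ≤ (timeTotalVariation μ (u + φ) A a b).toReal := by
  obtain ⟨hBV, hvar⟩ := hu
  have hAΩ : A ⊆ Ω := subset_closure.trans hA.2.2
  obtain ⟨U, s₁, s₂, hU, hUΩ, hs₁, hs, hs₂, hsupp, hfin, hineq⟩ := hvar φ (hφ.mono hAΩ)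
  obtain ⟨L, hL⟩ := hφ.lipschitz
  -- The support may touch the times `a` and `b`, hence the closed interval; it differs from the
  -- open one by a null set.
  have hsuppA : tsupport φ ⊆ A ×ˢ Icc a b := by
    have hcl : tsupport φ ⊆ Prod.snd ⁻¹' Icc a b :=
      closure_minimal (fun p hp => Ioo_subset_Icc_self (by
        by_contra hcon
        exact hp (hφ0 p.1 p.2 hcon))) (isClosed_Icc.preimage continuous_snd)
    exact fun p hp => ⟨(hφ.tsupport_subset hp).1, hcl hp⟩
  have hI : ∫ t in Ioo s₁ s₂, ∫ x in U, -(u (x, t) * timeDeriv φ x t) ∂μ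
      = ∫ t in Ioo a b, ∫ x in A, -(u (x, t) * timeDeriv φ x t) ∂μ := by
    rw [integral_mul_timeDeriv_eq_of_tsupport_subset hsupp, ← integral_Icc_eq_integral_Ioo,
      integral_mul_timeDeriv_eq_of_tsupport_subset hsuppA]
  rw [hI] at hineq
  have hzero : ∀ t ∉ Ioo s₁ s₂, ∀ x, φ (x, t) = 0 := fun t ht x =>
    image_eq_zero_of_notMem_tsupport fun h => ht (hsupp h).2
  have hslice_eq : ∀ t, (∀ x, φ (x, t) = 0) → ∀ B,
      totalVariation μ (fun x => (u + φ) (x, t)) B = totalVariation μ (fun x => u (x, t)) B := by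
    intro t ht B
    simp only [Pi.add_apply, ht, add_zero]
  have hmeas : ∀ᵐ t ∂volume.restrict (Ioo s₁ s₂),
      AEMeasurable (fun x => u (x, t)) (μ.restrict Ω) :=
    (hBV.aestronglyMeasurable_prod subset_rfl hs₁ hs₂).prod_swap.prodMk_left.mono
      fun t ht => ht.aemeasurable
  set K := Prod.fst '' tsupport φ with hK
  have hKUA : K ⊆ U ∩ A := by
    rintro _ ⟨p, hp, rfl⟩
    exact ⟨(hsupp hp).1, (hsuppA hp).1⟩
  set γ : ℝ → ℝ≥0∞ := fun t => totalVariation μ (fun x => u (x, t)) A with hγ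
  set δ : ℝ → ℝ≥0∞ := fun t => totalVariation μ (fun x => (u + φ) (x, t)) A with hδ
  have hpt : ∀ᵐ t ∂volume.restrict (Ioo s₁ s₂),
      totalVariation μ (fun x => (u + φ) (x, t)) U + (Ioo a b).indicator γ t
        ≤ totalVariation μ (fun x => u (x, t)) U + (Ioo a b).indicator δ t := by
    filter_upwards [hmeas] with t ht
    by_cases htab : t ∈ Ioo a b
    · rw [indicator_of_mem htab, indicator_of_mem htab]
      have hφt : Measurable fun x => φ (x, t) := (lipschitzWith_slice hL t).continuous.measurable
      refine totalVariation_add_le_of_eq_off_compact hU hA.1 hφ.isCompact_image_fst hKUA ?_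
        ((ht.mono_set hAΩ).add hφt.aemeasurable) (ht.mono_set hUΩ)
      intro x hx
      rw [Pi.add_apply, eq_zero_of_notMem_image_fst_tsupport hx t, add_zero]
    · rw [indicator_of_notMem htab, indicator_of_notMem htab,
        hslice_eq t (fun x => hφ0 x t htab)]
  have hδm : AEMeasurable δ (volume.restrict (Ioo a b)) :=
    hBV.aemeasurable_totalVariation_add hA ha hab hb hφ
  have hδm' : AEMeasurable ((Ioo a b).indicator δ) (volume.restrict (Ioo s₁ s₂)) := by
    rw [aemeasurable_indicator_iff measurableSet_Ioo, Measure.restrict_restrict measurableSet_Ioo]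
    exact hδm.mono_set inter_subset_left
  have hsum : timeTotalVariation μ (u + φ) U s₁ s₂ + ∫⁻ t in Ioo a b ∩ Ioo s₁ s₂, γ t
      ≤ timeTotalVariation μ u U s₁ s₂ + ∫⁻ t in Ioo a b ∩ Ioo s₁ s₂, δ t := by
    -- Slices need not be integrable over `U`, so measurability in time of total variations over `U`
    -- is not available. Superadditivity of the lower integral handles the left side, and on the
    -- right it is enough that `δ` is measurable.
    have h1 := (le_lintegral_add _ _).trans (lintegral_mono_ae hpt)
    rwa [lintegral_add_right' _ hδm', lintegral_indicator measurableSet_Ioo,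
      lintegral_indicator measurableSet_Ioo, Measure.restrict_restrict measurableSet_Ioo] at h1
  -- The interval `(a, b)` need not lie in `(s₁, s₂)`; at the remaining times `φ` vanishes.
  have hrest : ∫⁻ t in Ioo a b \ Ioo s₁ s₂, γ t = ∫⁻ t in Ioo a b \ Ioo s₁ s₂, δ t :=
    setLIntegral_congr_fun (measurableSet_Ioo.diff measurableSet_Ioo)
      fun t ht => (hslice_eq t (hzero t ht.2) A).symm
  have hsum' : timeTotalVariation μ (u + φ) U s₁ s₂ + timeTotalVariation μ u A a b
      ≤ timeTotalVariation μ u U s₁ s₂ + timeTotalVariation μ (u + φ) A a b := by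
    have hγs : timeTotalVariation μ u A a b = _ :=
      (lintegral_inter_add_sdiff γ (Ioo a b) (measurableSet_Ioo (a := s₁) (b := s₂))).symm
    have hδs : timeTotalVariation μ (u + φ) A a b = _ :=
      (lintegral_inter_add_sdiff δ (Ioo a b) (measurableSet_Ioo (a := s₁) (b := s₂))).symm
    rw [hγs, hδs, ← add_assoc, ← add_assoc, hrest]
    exact add_le_add hsum le_rfl
  have hfinA := hBV.timeTotalVariation_lt_top hA ha hab hb
  have hfinA' := hBV.timeTotalVariation_add_lt_top hA ha hab hb hL
  -- The definition assumes finiteness only for `u`; the exchange inequality supplies it for `u +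
  -- φ`, so the terms over `U` can be cancelled in `ℝ`.
  have hfinU : timeTotalVariation μ (u + φ) U s₁ s₂ < ⊤ :=
    (le_self_add.trans hsum').trans_lt (ENNReal.add_lt_top.2 ⟨hfin, hfinA'⟩)
  rw [← EReal.coe_ennreal_toReal hfin.ne, ← EReal.coe_ennreal_toReal hfinU.ne,
    ← EReal.coe_add, EReal.coe_le_coe_iff] at hineq
  have hreal := ENNReal.toReal_mono (ENNReal.add_lt_top.2 ⟨hfin, hfinA'⟩).ne hsum'
  rw [ENNReal.toReal_add hfinU.ne hfinA.ne, ENNReal.toReal_add hfin.ne hfinA'.ne] at hreal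
  linarith

end Localization

/-! ### The cutoff in time -/

section Trapezoid

/-- The piecewise linear cutoff in time, which vanishes outside `(a, b)` and equals `1` on
`[a + h, b - h]`. -/
def trapezoid (a b h t : ℝ) : ℝ := max 0 (min 1 (min (h⁻¹ * (t - a)) (h⁻¹ * (b - t))))

variable {a b h t : ℝ}

theorem trapezoid_nonneg : 0 ≤ trapezoid a b h t := le_max_left _ _

theorem trapezoid_le_one : trapezoid a b h t ≤ 1 := max_le zero_le_one (min_le_left _ _)

theorem abs_trapezoid_le_one : |trapezoid a b h t| ≤ 1 :=
  abs_le.2 ⟨by linarith [trapezoid_nonneg (a := a) (b := b) (h := h) (t := t)], trapezoid_le_one⟩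

theorem lipschitzWith_trapezoid (hh : 0 < h) :
    LipschitzWith (h⁻¹).toNNReal (trapezoid a b h) := by
  have key : ∀ c d : ℝ, |d| = 1 → LipschitzWith (h⁻¹).toNNReal fun t => h⁻¹ * (c + d * t) := by
    intro c d hd
    refine LipschitzWith.of_dist_le_mul fun s t => ?_
    rw [Real.coe_toNNReal _ (inv_pos.2 hh).le, Real.dist_eq, Real.dist_eq, ← mul_sub,
      add_sub_add_left_eq_sub, ← mul_sub, abs_mul, abs_mul, hd, one_mul,
      abs_of_pos (inv_pos.2 hh)]
  refine LipschitzWith.const_max (LipschitzWith.const_min ?_ _) _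
  have h1 := (key (-a) 1 (by simp)).min (key b (-1) (by simp))
  rw [max_self] at h1
  convert h1 using 4 <;> ring

theorem trapezoid_eq_zero (hh : 0 < h) (ht : t ∉ Ioo a b) : trapezoid a b h t = 0 := by
  refine max_eq_left (min_le_of_right_le ?_)
  rw [mem_Ioo, not_and_or, not_lt, not_lt] at ht
  rcases ht with ht | ht
  · exact min_le_of_left_le (mul_nonpos_of_nonneg_of_nonpos (inv_pos.2 hh).le (by linarith))
  · exact min_le_of_right_le (mul_nonpos_of_nonneg_of_nonpos (inv_pos.2 hh).le (by linarith))

theorem trapezoid_eq_one (hh : 0 < h) (h1 : a + h ≤ t) (h2 : t ≤ b - h) :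
    trapezoid a b h t = 1 := by
  have e1 : 1 ≤ h⁻¹ * (t - a) := by rw [le_inv_mul_iff₀ hh]; linarith
  have e2 : 1 ≤ h⁻¹ * (b - t) := by rw [le_inv_mul_iff₀ hh]; linarith
  rw [trapezoid, min_eq_left (le_min e1 e2), max_eq_right zero_le_one]

theorem trapezoid_eq_left (hh : 0 < h) (hhab : a + h < b - h) (h1 : a < t) (h2 : t < a + h) :
    trapezoid a b h t = h⁻¹ * (t - a) := by
  have e1 : h⁻¹ * (t - a) ≤ 1 := by rw [inv_mul_le_iff₀ hh]; linarith
  have e2 : h⁻¹ * (t - a) ≤ h⁻¹ * (b - t) :=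
    mul_le_mul_of_nonneg_left (by linarith) (inv_pos.2 hh).le
  rw [trapezoid, min_eq_left e2, min_eq_right e1, max_eq_right]
  exact mul_nonneg (inv_pos.2 hh).le (by linarith)

theorem trapezoid_eq_right (hh : 0 < h) (hhab : a + h < b - h) (h1 : b - h < t) (h2 : t < b) :
    trapezoid a b h t = h⁻¹ * (b - t) := by
  have e1 : h⁻¹ * (b - t) ≤ 1 := by rw [inv_mul_le_iff₀ hh]; linarith
  have e2 : h⁻¹ * (b - t) ≤ h⁻¹ * (t - a) :=
    mul_le_mul_of_nonneg_left (by linarith) (inv_pos.2 hh).le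
  rw [trapezoid, min_eq_right e2, min_eq_right e1, max_eq_right]
  exact mul_nonneg (inv_pos.2 hh).le (by linarith)

theorem hasDerivAt_trapezoid (hh : 0 < h) (hhab : a + h < b - h) (ht : t ∈ Ioo a b)
    (h1 : t ≠ a + h) (h2 : t ≠ b - h) :
    HasDerivAt (trapezoid a b h) (h⁻¹ * ((Ioo a (a + h)).indicator (fun _ => 1) t
      - (Ioo (b - h) b).indicator (fun _ => 1) t)) t := by
  rcases lt_or_gt_of_ne h1 with h1 | h1
  · have hd : HasDerivAt (fun t => h⁻¹ * (t - a)) (h⁻¹ * 1) t :=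
      ((hasDerivAt_id t).sub_const a).const_mul _
    rw [indicator_of_mem (show t ∈ Ioo a (a + h) from ⟨ht.1, h1⟩),
      indicator_of_notMem (fun hmem => by linarith [hmem.1]), sub_zero]
    refine hd.congr_of_eventuallyEq ?_
    filter_upwards [Ioo_mem_nhds ht.1 h1] with s hs
    exact trapezoid_eq_left hh hhab hs.1 hs.2
  · rw [indicator_of_notMem (fun hmem => by linarith [hmem.2])]
    rcases lt_or_gt_of_ne h2 with h2 | h2
    · rw [indicator_of_notMem (fun hmem => by linarith [hmem.1]), sub_zero, mul_zero]
      refine (hasDerivAt_const t (1 : ℝ)).congr_of_eventuallyEq ?_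
      filter_upwards [Ioo_mem_nhds h1 h2] with s hs
      exact trapezoid_eq_one hh hs.1.le hs.2.le
    · have hd : HasDerivAt (fun t => h⁻¹ * (b - t)) (h⁻¹ * (-1)) t :=
        ((hasDerivAt_id t).const_sub b).const_mul _
      rw [indicator_of_mem (show t ∈ Ioo (b - h) b from ⟨h2, ht.2⟩), zero_sub]
      refine hd.congr_of_eventuallyEq ?_
      filter_upwards [Ioo_mem_nhds h2 ht.2] with s hs
      exact trapezoid_eq_right hh hhab hs.1 hs.2

theorem tendsto_trapezoid (ht : t ∈ Ioo a b) :
    Tendsto (fun h => trapezoid a b h t) (𝓝[>] 0) (𝓝 1) := by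
  refine tendsto_const_nhds.congr' ?_
  have hsmall : ∀ᶠ h : ℝ in 𝓝[>] 0, h < min (t - a) (b - t) :=
    nhdsWithin_le_nhds (eventually_lt_nhds (lt_min (sub_pos.2 ht.1) (sub_pos.2 ht.2)))
  filter_upwards [hsmall, self_mem_nhdsWithin] with h h1 h2
  rw [trapezoid_eq_one h2] <;> linarith [h1.trans_le (min_le_left _ _),
    h1.trans_le (min_le_right _ _)]

variable {X : Type*} [MetricSpace X] {A : Set X} {s₁ s₂ : ℝ} {φ : X × ℝ → ℝ}

theorem IsTestFunction.trapezoid_mul (hφ : IsTestFunction A s₁ s₂ φ) (hh : 0 < h) :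
    IsTestFunction A s₁ s₂ fun p => trapezoid a b h p.2 * φ p := by
  obtain ⟨L, hL⟩ := hφ.lipschitz
  obtain ⟨M, hM⟩ := hφ.exists_bound
  refine ⟨⟨L + (h⁻¹).toNNReal * M, LipschitzWith.of_dist_le_mul fun p p' => ?_⟩,
    hφ.hasCompactSupport.mul_left, (tsupport_mul_subset_right).trans hφ.tsupport_subset⟩
  have h1 := hL.dist_le_mul p p'
  have h2 := (lipschitzWith_trapezoid (a := a) (b := b) hh).dist_le_mul p.2 p'.2
  have h3 : dist p.2 p'.2 ≤ dist p p' := le_max_right _ _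
  rw [Real.dist_eq] at h1 h2 ⊢
  have hsplit : trapezoid a b h p.2 * φ p - trapezoid a b h p'.2 * φ p'
      = trapezoid a b h p.2 * (φ p - φ p')
        + (trapezoid a b h p.2 - trapezoid a b h p'.2) * φ p' := by ring
  rw [hsplit]
  calc |trapezoid a b h p.2 * (φ p - φ p')
        + (trapezoid a b h p.2 - trapezoid a b h p'.2) * φ p'|
      ≤ |trapezoid a b h p.2| * |φ p - φ p'|
        + |trapezoid a b h p.2 - trapezoid a b h p'.2| * |φ p'| := by
        rw [← abs_mul, ← abs_mul]; exact abs_add_le _ _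
    _ ≤ 1 * (L * dist p p') + ((h⁻¹).toNNReal * dist p p') * M := by
        gcongr
        · exact abs_trapezoid_le_one
        · exact h2.trans (by gcongr)
        · exact hM p'
    _ = _ := by push_cast; ring

/-- The constant in space does not depend on `h`, although the one in time blows up; this keeps the
total variation on the ramps under control. -/
theorem lipschitzWith_trapezoid_mul_slice {L : ℝ≥0} (hL : LipschitzWith L φ) (t : ℝ) :
    LipschitzWith L fun x => trapezoid a b h t * φ (x, t) :=
  LipschitzWith.of_dist_le_mul fun x y => by
    have := (lipschitzWith_slice hL t).dist_le_mul x y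
    rw [Real.dist_eq] at this ⊢
    rw [← mul_sub, abs_mul]
    exact (mul_le_of_le_one_left (abs_nonneg _) abs_trapezoid_le_one).trans this

end Trapezoid

/-! ### The time derivative of a Lipschitz function -/

section TimeDerivative

variable {X : Type*} [MetricSpace X] {φ : X × ℝ → ℝ} {L : ℝ≥0}

theorem lipschitzWith_time_slice (hφ : LipschitzWith L φ) (x : X) :
    LipschitzWith L fun t => φ (x, t) :=
  LipschitzWith.of_dist_le_mul fun s t => by
    have := hφ.dist_le_mul (x, s) (x, t)
    rwa [dist_prod_same_left] at this

theorem abs_timeDeriv_le (hφ : LipschitzWith L φ) (x : X) (t : ℝ) : |timeDeriv φ x t| ≤ L :=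
  norm_deriv_le_of_lipschitz (lipschitzWith_time_slice hφ x)

variable [MeasurableSpace X] [OpensMeasurableSpace X]

theorem measurable_timeDeriv (hφ : Continuous φ) :
    Measurable fun p : X × ℝ => timeDeriv φ p.1 p.2 :=
  measurable_deriv_with_param (f := fun x t => φ (x, t)) hφ

/-- For every `x` the function of time is Lipschitz, hence differentiable almost everywhere; Fubini
exchanges the quantifiers. -/
theorem ae_ae_differentiableAt (hφ : LipschitzWith L φ) (ν : Measure X) [SFinite ν] :
    ∀ᵐ t : ℝ, ∀ᵐ x ∂ν, DifferentiableAt ℝ (fun s => φ (x, s)) t := by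
  have hms : MeasurableSet {p : X × ℝ | DifferentiableAt ℝ (fun s => φ (p.1, s)) p.2} :=
    measurableSet_of_differentiableAt_with_param ℝ (f := fun x t => φ (x, t)) hφ.continuous
  exact (Measure.ae_ae_comm hms).1 (Eventually.of_forall fun x =>
    (lipschitzWith_time_slice hφ x).ae_differentiableAt_real)

end TimeDerivative

/-! ### Shrinking the ramps -/

section Limit

variable {X : Type*} [MetricSpace X] [ProperSpace X] [MeasurableSpace X] [BorelSpace X]
  {μ : Measure X} [IsLocallyFiniteMeasure μ] {Ω A : Set X} {T a b h : ℝ} {u φ : X × ℝ → ℝ}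

/-- Product rule: the cutoff has slope `h⁻¹` on the first ramp and `-h⁻¹` on the last, so its
derivative produces averages over the ramps, the future boundary terms. -/
theorem MemL1LocBVLoc.integral_mul_timeDeriv_trapezoid (hu : MemL1LocBVLoc μ Ω T u)
    (hA : CompactlyInside A Ω) (ha : 0 < a) (hab : a < b) (hb : b < T)
    (hφ : IsTestFunction A 0 T φ) (hh : 0 < h) (hhab : a + h < b - h) :
    ∫ t in Ioo a b, ∫ x in A,
        -(u (x, t) * timeDeriv (fun p => trapezoid a b h p.2 * φ p) x t) ∂μ
      = -((∫ t in Ioo a b, trapezoid a b h t * ∫ x in A, u (x, t) * timeDeriv φ x t ∂μ)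
        + ((h⁻¹ * ∫ t in Ioo a (a + h), ∫ x in A, u (x, t) * φ (x, t) ∂μ)
          - h⁻¹ * ∫ t in Ioo (b - h) b, ∫ x in A, u (x, t) * φ (x, t) ∂μ)) := by
  obtain ⟨L, hL⟩ := hφ.lipschitz
  obtain ⟨M, hM⟩ := hφ.exists_bound
  set m : ℝ → ℝ := fun t => ∫ x in A, u (x, t) * φ (x, t) ∂μ with hm
  set q : ℝ → ℝ := fun t => ∫ x in A, u (x, t) * timeDeriv φ x t ∂μ with hq
  have hmi := hu.integrable_prod_mul hA ha hab hb hφ.continuous.measurable hM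
  have hqi := hu.integrable_prod_mul hA ha hab hb (measurable_timeDeriv hφ.continuous)
    (fun p => abs_timeDeriv_le hL p.1 p.2)
  have hmi' : IntegrableOn m (Ioo a b) := hmi.integral_prod_right
  have hqi' : IntegrableOn q (Ioo a b) := hqi.integral_prod_right
  have hmain : ∀ᵐ t ∂volume.restrict (Ioo a b),
      ∫ x in A, -(u (x, t) * timeDeriv (fun p => trapezoid a b h p.2 * φ p) x t) ∂μ
        = -(trapezoid a b h t * q t + h⁻¹ * ((Ioo a (a + h)).indicator m t
          - (Ioo (b - h) b).indicator m t)) := by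
    filter_upwards [hmi.prod_left_ae, hqi.prod_left_ae, ae_restrict_mem measurableSet_Ioo,
      ae_restrict_of_ae (ae_ae_differentiableAt hL (μ.restrict A)),
      ae_restrict_of_ae (Measure.ae_ne volume (a + h)),
      ae_restrict_of_ae (Measure.ae_ne volume (b - h))] with t ht1 ht2 htab hdiff hne1 hne2
    set e : ℝ := h⁻¹ * ((Ioo a (a + h)).indicator (fun _ => 1) t
      - (Ioo (b - h) b).indicator (fun _ => 1) t) with he
    have hderiv : ∀ᵐ x ∂μ.restrict A,
        -(u (x, t) * timeDeriv (fun p => trapezoid a b h p.2 * φ p) x t)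
          = -(e * (u (x, t) * φ (x, t)) + trapezoid a b h t * (u (x, t) * timeDeriv φ x t)) := by
      filter_upwards [hdiff] with x hx
      have hd := (hasDerivAt_trapezoid hh hhab htab hne1 hne2).mul hx.hasDerivAt
      have hd' : timeDeriv (fun p => trapezoid a b h p.2 * φ p) x t
          = e * φ (x, t) + trapezoid a b h t * timeDeriv φ x t := hd.deriv
      rw [hd']
      ring
    rw [integral_congr_ae hderiv, integral_neg, integral_add (ht1.const_mul e)
      (ht2.const_mul (trapezoid a b h t)), integral_const_mul, integral_const_mul]
    have hind : ∀ S : Set ℝ, S.indicator m t = S.indicator (fun _ => (1 : ℝ)) t * m t := by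
      intro S
      by_cases htS : t ∈ S <;> simp [htS]
    rw [hind, hind, he]
    ring
  have hsub1 : Ioo a (a + h) ⊆ Ioo a b := Ioo_subset_Ioo le_rfl (by linarith)
  have hsub2 : Ioo (b - h) b ⊆ Ioo a b := Ioo_subset_Ioo (by linarith) le_rfl
  have hi1 : IntegrableOn (fun t => trapezoid a b h t * q t) (Ioo a b) :=
    hqi'.bdd_mul (lipschitzWith_trapezoid hh).continuous.aestronglyMeasurable
      (Eventually.of_forall fun t => abs_trapezoid_le_one)
  have hi2 : IntegrableOn ((Ioo a (a + h)).indicator m) (Ioo a b) :=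
    hmi'.indicator measurableSet_Ioo
  have hi3 : IntegrableOn ((Ioo (b - h) b).indicator m) (Ioo a b) :=
    hmi'.indicator measurableSet_Ioo
  have hi4 : IntegrableOn (fun t => h⁻¹ * ((Ioo a (a + h)).indicator m t
      - (Ioo (b - h) b).indicator m t)) (Ioo a b) := (hi2.sub hi3).const_mul _
  rw [integral_congr_ae hmain, integral_neg, integral_add hi1 hi4,
    integral_const_mul, integral_sub hi2 hi3, setIntegral_indicator measurableSet_Ioo,
    setIntegral_indicator measurableSet_Ioo, inter_eq_right.2 hsub1, inter_eq_right.2 hsub2]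
  ring

theorem MemL1LocBVLoc.timeTotalVariation_add_trapezoid_le (hu : MemL1LocBVLoc μ Ω T u)
    (hA : CompactlyInside A Ω) (ha : 0 < a) (hab : a < b) (hb : b < T)
    (hφ : IsTestFunction A 0 T φ) {L : ℝ≥0} (hL : LipschitzWith L φ) (hh : 0 < h) :
    timeTotalVariation μ (u + fun p => trapezoid a b h p.2 * φ p) A a b
      ≤ timeTotalVariation μ (u + φ) A a b
        + ∫⁻ t in Ioo a (a + h) ∪ Ioo (b - h) b,
          (totalVariation μ (fun x => u (x, t)) A + L * μ A) ∂volume.restrict (Ioo a b) := by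
  have hm : MeasurableSet (Ioo a (a + h) ∪ Ioo (b - h) b) :=
    measurableSet_Ioo.union measurableSet_Ioo
  rw [timeTotalVariation, timeTotalVariation, ← lintegral_indicator hm,
    ← lintegral_add_left' (hu.aemeasurable_totalVariation_add hA ha hab hb hφ)]
  refine setLIntegral_mono_ae' measurableSet_Ioo (Eventually.of_forall fun t ht => ?_)
  by_cases htB : t ∈ Ioo a (a + h) ∪ Ioo (b - h) b
  · rw [indicator_of_mem htB]
    exact le_add_left (totalVariation_add_lipschitz_le hA.1.measurableSet
      (lipschitzWith_trapezoid_mul_slice hL t))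
  · have h1 : a + h ≤ t := by
      by_contra hcon
      exact htB (Or.inl ⟨ht.1, not_le.1 hcon⟩)
    have h2 : t ≤ b - h := by
      by_contra hcon
      exact htB (Or.inr ⟨not_le.1 hcon, ht.2⟩)
    simp only [Pi.add_apply, trapezoid_eq_one hh h1 h2, one_mul]
    exact le_self_add

theorem IsVariationalSolution.inequality_of_isSliceLebesguePoint
    (hu : IsVariationalSolution μ Ω T u) (hA : CompactlyInside A Ω) (ha : 0 < a) (hab : a < b)
    (hb : b < T) (hφ : IsTestFunction A 0 T φ)
    {A₁ A₂ : Set X} (hA₁ : CompactlyInside A₁ Ω) (hAA₁ : A ⊆ A₁)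
    (h₁ : IsSliceLebesguePoint μ A₁ u a) (hA₂ : CompactlyInside A₂ Ω) (hAA₂ : A ⊆ A₂)
    (h₂ : IsSliceLebesguePoint μ A₂ u b) :
    (∫ t in Ioo a b, ∫ x in A, -(u (x, t) * timeDeriv φ x t) ∂μ)
        + (timeTotalVariation μ u A a b).toReal
      ≤ (timeTotalVariation μ (u + φ) A a b).toReal
        - ((∫ x in A, u (x, b) * φ (x, b) ∂μ) - ∫ x in A, u (x, a) * φ (x, a) ∂μ) := by
  have hBV := hu.1
  obtain ⟨L, hL⟩ := hφ.lipschitz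
  obtain ⟨M, hM⟩ := hφ.exists_bound
  set q : ℝ → ℝ := fun t => ∫ x in A, u (x, t) * timeDeriv φ x t ∂μ with hq
  set m : ℝ → ℝ := fun t => ∫ x in A, u (x, t) * φ (x, t) ∂μ with hm
  -- The Lebesgue points are known for the larger sets `A₁`, `A₂`, but `φ` vanishes off `A`.
  have hset : ∀ {B : Set X}, A ⊆ B → ∀ t, ∫ x in B, u (x, t) * φ (x, t) ∂μ = m t := by
    intro B hAB t
    have hz : ∀ x ∉ A, u (x, t) * φ (x, t) = 0 := fun x hx => by
      rw [image_eq_zero_of_notMem_tsupport fun hmem => hx (hφ.tsupport_subset hmem).1, mul_zero]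
    rw [setIntegral_eq_integral_of_forall_compl_eq_zero fun x hx => hz x fun hxA => hx (hAB hxA)]
    exact (setIntegral_eq_integral_of_forall_compl_eq_zero hz).symm
  have hlim₁ : Tendsto (fun h => h⁻¹ * ∫ s in Ioo a (a + h), m s) (𝓝[>] 0) (𝓝 (m a)) := by
    have := hBV.tendsto_average_integral_mul hA₁ ⟨ha, hab.trans hb⟩ h₁ hL hM
      (J := fun h => Ioo a (a + h)) (fun h s hs => by
        rw [Real.closedBall_eq_Icc]
        exact ⟨by linarith [hs.1, hs.2], hs.2.le⟩) (fun _ => measurableSet_Ioo)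
      (fun h => by rw [Real.volume_Ioo, add_sub_cancel_left])
    simpa only [hset hAA₁] using this
  have hlim₂ : Tendsto (fun h => h⁻¹ * ∫ s in Ioo (b - h) b, m s) (𝓝[>] 0) (𝓝 (m b)) := by
    have := hBV.tendsto_average_integral_mul hA₂ ⟨ha.trans hab, hb⟩ h₂ hL hM
      (J := fun h => Ioo (b - h) b) (fun h s hs => by
        rw [Real.closedBall_eq_Icc]
        exact ⟨hs.1.le, by linarith [hs.1, hs.2]⟩) (fun _ => measurableSet_Ioo)
      (fun h => by rw [Real.volume_Ioo, sub_sub_cancel])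
    simpa only [hset hAA₂] using this
  have hqi : IntegrableOn q (Ioo a b) :=
    (hBV.integrable_prod_mul hA ha hab hb (measurable_timeDeriv hφ.continuous)
      (fun p => abs_timeDeriv_le hL p.1 p.2)).integral_prod_right
  have hlimq : Tendsto (fun h => ∫ t in Ioo a b, trapezoid a b h t * q t) (𝓝[>] 0)
      (𝓝 (∫ t in Ioo a b, q t)) := by
    refine tendsto_integral_filter_of_dominated_convergence (fun t => ‖q t‖) ?_ ?_ hqi.norm ?_
    · filter_upwards [self_mem_nhdsWithin] with h hh
      exact (lipschitzWith_trapezoid hh).continuous.aestronglyMeasurable.mul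
        hqi.aestronglyMeasurable
    · refine Eventually.of_forall fun h => Eventually.of_forall fun t => ?_
      rw [norm_mul]
      exact mul_le_of_le_one_left (norm_nonneg _) abs_trapezoid_le_one
    · filter_upwards [ae_restrict_mem measurableSet_Ioo] with t ht
      simpa using (tendsto_trapezoid ht).mul_const (q t)
  set R : ℝ → ℝ≥0∞ := fun h => ∫⁻ t in Ioo a (a + h) ∪ Ioo (b - h) b,
    (totalVariation μ (fun x => u (x, t)) A + L * μ A) ∂volume.restrict (Ioo a b) with hR
  have hfin : timeTotalVariation μ u A a b < ⊤ := hBV.timeTotalVariation_lt_top hA ha hab hb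
  have hfin' : timeTotalVariation μ (u + φ) A a b < ⊤ :=
    hBV.timeTotalVariation_add_lt_top hA ha hab hb hL
  have hFfin : ∫⁻ t in Ioo a b, (totalVariation μ (fun x => u (x, t)) A + L * μ A) ≠ ⊤ := by
    rw [lintegral_add_right _ measurable_const, setLIntegral_const]
    exact ENNReal.add_ne_top.2 ⟨hfin.ne, ENNReal.mul_ne_top
      (ENNReal.mul_ne_top ENNReal.coe_ne_top hA.measure_lt_top.ne) measure_Ioo_lt_top.ne⟩
  have hRfin : ∀ h, R h ≠ ⊤ := fun h =>
    ne_top_of_le_ne_top hFfin (setLIntegral_le_lintegral _ _)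
  -- Absolute continuity of the integral: the ramps have total length at most `2 * h`.
  have hlimR : Tendsto R (𝓝[>] 0) (𝓝 0) := by
    refine tendsto_setLIntegral_zero hFfin ?_
    have hb0 : Tendsto (fun h : ℝ => ENNReal.ofReal h + ENNReal.ofReal h) (𝓝[>] 0) (𝓝 0) := by
      have : Tendsto (fun h : ℝ => ENNReal.ofReal h) (𝓝[>] 0) (𝓝 0) := by
        have := (ENNReal.continuous_ofReal.tendsto 0).mono_left
          (nhdsWithin_le_nhds (s := Ioi (0 : ℝ)))
        rwa [ENNReal.ofReal_zero] at this
      simpa using this.add this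
    refine tendsto_of_tendsto_of_tendsto_of_le_of_le tendsto_const_nhds hb0 (fun _ => bot_le)
      fun h => ?_
    refine (Measure.restrict_apply_le _ _).trans ((measure_union_le _ _).trans ?_)
    rw [Real.volume_Ioo, Real.volume_Ioo, add_sub_cancel_left, sub_sub_cancel]
  have hlimR' : Tendsto (fun h => (R h).toReal) (𝓝[>] 0) (𝓝 0) :=
    (ENNReal.tendsto_toReal ENNReal.zero_ne_top).comp hlimR
  have hineq : ∀ᶠ h in 𝓝[>] (0 : ℝ),
      -((∫ t in Ioo a b, trapezoid a b h t * q t)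
        + ((h⁻¹ * ∫ t in Ioo a (a + h), m t) - h⁻¹ * ∫ t in Ioo (b - h) b, m t))
        + (timeTotalVariation μ u A a b).toReal
      ≤ (timeTotalVariation μ (u + φ) A a b).toReal + (R h).toReal := by
    have hsmall : ∀ᶠ h : ℝ in 𝓝[>] 0, h < (b - a) / 2 :=
      nhdsWithin_le_nhds (eventually_lt_nhds (by linarith))
    filter_upwards [hsmall, self_mem_nhdsWithin] with h hlt hh
    have hloc := hu.localized hA ha hab hb (hφ.trapezoid_mul (a := a) (b := b) hh)
      (fun x t ht => by rw [trapezoid_eq_zero hh ht, zero_mul])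
    rw [hBV.integral_mul_timeDeriv_trapezoid hA ha hab hb hφ hh (by linarith)] at hloc
    refine hloc.trans ?_
    rw [← ENNReal.toReal_add hfin'.ne (hRfin h)]
    exact ENNReal.toReal_mono (ENNReal.add_ne_top.2 ⟨hfin'.ne, hRfin h⟩)
      (hBV.timeTotalVariation_add_trapezoid_le hA ha hab hb hφ hL hh)
  have hfinal := le_of_tendsto_of_tendsto
    (((hlimq.add (hlim₁.sub hlim₂)).neg).add_const (timeTotalVariation μ u A a b).toReal)
    (hlimR'.const_add (timeTotalVariation μ (u + φ) A a b).toReal) hineq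
  have hqneg : ∫ t in Ioo a b, ∫ x in A, -(u (x, t) * timeDeriv φ x t) ∂μ
      = -∫ t in Ioo a b, q t := by
    simp only [integral_neg, hq]
  rw [hqneg]
  linarith

end Limit

end TVF

end

/-! ### The proposition -/

theorem proposition3p2 {X : Type*} [MetricSpace X] [CompleteSpace X]
    [MeasurableSpace X] [BorelSpace X]
    (μ : MeasureTheory.Measure X) (hμ : TVF.IsDoubling μ) (hP : TVF.SupportsPoincare μ)
    (Ω : Set X) (hΩ : IsOpen Ω) (T : ℝ) (hT : 0 < T)
    (u : X × ℝ → ℝ) (hu : TVF.IsVariationalSolution μ Ω T u) :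
    ∃ N : Set ℝ, MeasureTheory.volume N = 0 ∧
      ∀ t₁ t₂ : ℝ, 0 < t₁ → t₁ < t₂ → t₂ < T → t₁ ∉ N → t₂ ∉ N →
      ∀ Ω' : Set X, TVF.CompactlyInside Ω' Ω →
      ∀ φ : X × ℝ → ℝ, TVF.IsTestFunction Ω' 0 T φ →
        MeasureTheory.IntegrableOn (fun x => u (x, t₁) * φ (x, t₁)) Ω' μ ∧
        MeasureTheory.IntegrableOn (fun x => u (x, t₂) * φ (x, t₂)) Ω' μ ∧
        MeasureTheory.IntegrableOn (fun p : X × ℝ => u p * TVF.timeDeriv φ p.1 p.2)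
          (Ω' ×ˢ Set.Ioo t₁ t₂) (μ.prod MeasureTheory.volume) ∧
        TVF.timeTotalVariation μ u Ω' t₁ t₂ < ⊤ ∧
        TVF.timeTotalVariation μ (u + φ) Ω' t₁ t₂ < ⊤ ∧
        (∫ t in Set.Ioo t₁ t₂, ∫ x in Ω', -(u (x, t) * TVF.timeDeriv φ x t) ∂μ)
            + (TVF.timeTotalVariation μ u Ω' t₁ t₂).toReal
          ≤ (TVF.timeTotalVariation μ (u + φ) Ω' t₁ t₂).toReal
            - ((∫ x in Ω', u (x, t₂) * φ (x, t₂) ∂μ)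
              - ∫ x in Ω', u (x, t₁) * φ (x, t₁) ∂μ) := by
  have := hμ.properSpace
  have := hμ.isLocallyFiniteMeasure
  have hBV := hu.1
  obtain ⟨N, hN, hLeb⟩ := hBV.exists_null_set hΩ hT
  refine ⟨N, hN, fun t₁ t₂ ht₁ h12 ht₂ hn₁ hn₂ A hA φ hφ => ?_⟩
  obtain ⟨A₁, hA₁, hAA₁, hL₁⟩ := hLeb t₁ ⟨ht₁, h12.trans ht₂⟩ hn₁ A hA
  obtain ⟨A₂, hA₂, hAA₂, hL₂⟩ := hLeb t₂ ⟨ht₁.trans h12, ht₂⟩ hn₂ A hA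
  obtain ⟨L, hL⟩ := hφ.lipschitz
  obtain ⟨M, hM⟩ := hφ.exists_bound
  have hslice : ∀ {B : Set X} {t : ℝ}, A ⊆ B →
      MeasureTheory.Integrable (fun x => u (x, t)) (μ.restrict B) →
      MeasureTheory.IntegrableOn (fun x => u (x, t) * φ (x, t)) A μ := fun {B t} hAB h =>
    (MeasureTheory.IntegrableOn.mono_set (f := fun x => u (x, t)) h hAB).mul_bdd
      (TVF.lipschitzWith_slice hL t).continuous.aestronglyMeasurable
      (Filter.Eventually.of_forall fun x => hM (x, t))
  refine ⟨hslice hAA₁ hL₁.1, hslice hAA₂ hL₂.1, ?_,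
    hBV.timeTotalVariation_lt_top hA ht₁ h12 ht₂,
    hBV.timeTotalVariation_add_lt_top hA ht₁ h12 ht₂ hL,
    hu.inequality_of_isSliceLebesguePoint hA ht₁ h12 ht₂ hφ hA₁ hAA₁ hL₁ hA₂ hAA₂ hL₂⟩
  rw [MeasureTheory.IntegrableOn, ← MeasureTheory.Measure.prod_restrict]
  exact hBV.integrable_prod_mul hA ht₁ h12 ht₂ (TVF.measurable_timeDeriv hφ.continuous)
    fun p => TVF.abs_timeDeriv_le hL p.1 p.2
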